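/- Let $-\infty<a<b<\infty$ and let $f$ be a probability density on $\mathbb{R}$ with $f>0$ exactly on $(a,b)$ and $f\in C^3((a,b))$. Put $f_1(x):=f(a+x)$ and $f_2(x):=f(b-x)$, and assume that for $i=1,2$ there are constants $\kappa_i>0$ and $A_i$ such that, as $x\to+0$ (where $g\cong h$ means $g/h\to1$, and $g\cong 0$ is not allowed), - $f_i(x)\cong A_i x^{\kappa_i-1}$; - if $\kappa_i\neq1$: $f_i'(x)\cong A_i(\kappa_i-1)x^{\kappa_i-2}$; - if $\kappa_i\neq1,2$: $f_i''(x)\cong A_i(\kappa_i-1)(\kappa_i-2)x^{\kappa_i-3}$; - if $\kappa_i=2$: $x f_i''(x)\to0$; - if $\kappa_i=1$: the finite limits $\lim_{x\to+0}f_i'(x)$ and $\lim_{x\to+0}f_i''(x)$ exist. For $\theta\in\mathbb{R}$ let $f_\theta(x):=f(x-\theta)$; for $0<s<1$ let $I^s(p\|q):=-\log\int p^s(x)q^{1-s}(x)\,dx$; let $B(\cdot,\cdot)$ be the beta function and $J_f:=\int_a^b f^{-1}(x)(f'(x))^2\,dx$. If $\kappa:=\kappa_1=\kappa_2$, then for every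 $\theta$: - if $0<\kappa<1$: $$\lim_{\epsilon\to+0}\frac{I^s(f_\theta\|f_{\theta+\epsilon})}{\epsilon^\kappa}=\frac{1-\kappa}{\kappa}\bigl(A_1sB(s+\kappa(1-s),1-\kappa)+A_2(1-s)B(1-s+\kappa s,1-\kappa)\bigr);$$ - if $\kappa=1$: $$\lim_{\epsilon\to+0}\frac{I^s(f_\theta\|f_{\theta+\epsilon})}{\epsilon^\kappa}=A_1s+A_2(1-s);$$ - if $1<\kappa<2$: $$\lim_{\epsilon\to+0}\frac{I^s(f_\theta\|f_{\theta+\epsilon})}{\epsilon^\kappa}=\frac{A_1s(1-s(\kappa-1))B(s+\kappa(1-s),2-\kappa)}{\kappa}+\frac{A_2(1-s)(1-(1-s)(\kappa-1))B(1-s+\kappa s,2-\kappa)}{\kappa};$$ - if $\kappa=2$: $$\lim_{\epsilon\to+0}\frac{I^s(f_\theta\|f_{\theta+\epsilon})}{-\epsilon^2\log\epsilon}=\frac{(A_1+A_2)s(1-s)}{2};$$ - if $\kappa>2$: $J_f<\infty$ and $$\lim_{\epsilon\to+0}\frac{I^s(f_\theta\|f_{\theta+\epsilon})}{\epsilon^2}=\frac{s(1-s)}{2}J_f.$$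 In every case the convergence is uniform in $s\in(0,1)$. If instead $\kappa_1<\kappa_2$, the same statements hold with $\kappa:=\kappa_1$ and with $A_2$ replaced by $0$ in the formulas. -/

import Mathlib

open MeasureTheory Set Filter Topology Asymptotics

/-- The relative Rényi entropy `I^s(p‖q) = -log ∫ p^s q^(1-s)` of two densities on the line. -/
noncomputable def relRenyi (s : ℝ) (p q : ℝ → ℝ) : ℝ :=
  -Real.log (∫ x, p x ^ s * q x ^ (1 - s))

/-- The member `f_θ(x) = f(x - θ)` of the location-shift family generated by `f`. -/
def locShift (f : ℝ → ℝ) (θ : ℝ) : ℝ → ℝ := fun x => f (x - θ)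

/-- The integral `J_f = ∫_a^b f⁻¹ (f')²`. -/
noncomputable def fisherIntegral (f : ℝ → ℝ) (a b : ℝ) : ℝ :=
  ∫ x in Ioo a b, (f x)⁻¹ * deriv f x ^ 2

/-- `f` is a probability density on the line, positive exactly on `(a, b)` and of class `C³`
there. -/
structure IsC3DensityOn (f : ℝ → ℝ) (a b : ℝ) : Prop where
  nonneg : ∀ x, 0 ≤ f x
  support_eq : Function.support f = Ioo a b
  contDiffOn : ContDiffOn ℝ 3 f (Ioo a b)
  integrable : Integrable f
  integral_eq_one : ∫ x, f x = 1

/-- The behaviour `g(x) ≅ A x^(κ-1)` as `x → +0`, with the matching conditions on `g'` and `g''`.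
It is applied to `g(x) = f(a + x)` and to `g(x) = f(b - x)`. -/
structure EndpointBehavior (g : ℝ → ℝ) (κ A : ℝ) : Prop where
  pos : 0 < κ
  equiv_zero : g ~[𝓝[>] 0] fun x => A * x ^ (κ - 1)
  equiv_one : κ ≠ 1 → deriv g ~[𝓝[>] 0] fun x => A * (κ - 1) * x ^ (κ - 2)
  equiv_two : κ ≠ 1 → κ ≠ 2 →
    deriv (deriv g) ~[𝓝[>] 0] fun x => A * (κ - 1) * (κ - 2) * x ^ (κ - 3)
  tendsto_two : κ = 2 → Tendsto (fun x => x * deriv (deriv g) x) (𝓝[>] 0) (𝓝 0)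
  limits_one : κ = 1 → (∃ l, Tendsto (deriv g) (𝓝[>] 0) (𝓝 l)) ∧
    ∃ l, Tendsto (deriv (deriv g)) (𝓝[>] 0) (𝓝 l)

/-- The limiting behaviour, with parameters `κ`, `A₁`, `A₂`, of `I^s(f_θ‖f_{θ+ε})` as `ε → +0`,
uniformly in `0 < s < 1`. The beta function is `ProbabilityTheory.beta`. -/
def RenyiLimits (f : ℝ → ℝ) (a b κ A₁ A₂ θ : ℝ) : Prop :=
  (0 < κ → κ < 1 →
    TendstoUniformlyOn
      (fun ε s => relRenyi s (locShift f θ) (locShift f (θ + ε)) / ε ^ κ)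
      (fun s => (1 - κ) / κ *
        (A₁ * s * ProbabilityTheory.beta (s + κ * (1 - s)) (1 - κ) +
          A₂ * (1 - s) * ProbabilityTheory.beta (1 - s + κ * s) (1 - κ)))
      (𝓝[>] 0) (Ioo 0 1)) ∧
  (κ = 1 →
    TendstoUniformlyOn
      (fun ε s => relRenyi s (locShift f θ) (locShift f (θ + ε)) / ε ^ κ)
      (fun s => A₁ * s + A₂ * (1 - s))
      (𝓝[>] 0) (Ioo 0 1)) ∧
  (1 < κ → κ < 2 →
    TendstoUniformlyOn
      (fun ε s => relRenyi s (locShift f θ) (locShift f (θ + ε)) / ε ^ κ)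
      (fun s =>
        A₁ * s * (1 - s * (κ - 1)) *
          ProbabilityTheory.beta (s + κ * (1 - s)) (2 - κ) / κ +
        A₂ * (1 - s) * (1 - (1 - s) * (κ - 1)) *
          ProbabilityTheory.beta (1 - s + κ * s) (2 - κ) / κ)
      (𝓝[>] 0) (Ioo 0 1)) ∧
  (κ = 2 →
    TendstoUniformlyOn
      (fun ε s => relRenyi s (locShift f θ) (locShift f (θ + ε)) / (-ε ^ 2 * Real.log ε))
      (fun s => (A₁ + A₂) * s * (1 - s) / 2)
      (𝓝[>] 0) (Ioo 0 1)) ∧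
  (2 < κ →
    IntegrableOn (fun x => (f x)⁻¹ * deriv f x ^ 2) (Ioo a b) ∧
    TendstoUniformlyOn
      (fun ε s => relRenyi s (locShift f θ) (locShift f (θ + ε)) / ε ^ 2)
      (fun s => s * (1 - s) / 2 * fisherIntegral f a b)
      (𝓝[>] 0) (Ioo 0 1))

/-! A density and its shift both have mass one, so `∫ p^s q^(1-s) = 1 - D`, where `D` integrates the
pointwise gap between weighted arithmetic and geometric means (`relRenyi_eq`). As `D → 0`, `-log (1
- D)` is asymptotic to `D`, so only the leading order of `D` matters. Cutting the line at `(a + b +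
ε) / 2` and reflecting the right half splits `D` into two integrals of one type, one per endpoint,
with `s` replaced by `1 - s` on the right (`integral_gap_eq`).

The gap is homogeneous of degree one, at most `p + q`, and at most `(p - q)^2 / min p q`. For a
profile `h u ≈ A u^(κ-1)` the last bound makes the gap between `h u` and `h (u - ε)` of order `ε^2
u^(κ-3)` once `u ≥ 2 ε`. The integrability of `u^(κ-3)` separates three regimes.

If `κ < 2`, the mass sits at the scale `u ~ ε`. Substituting `u = ε x`, dominated convergence gives
`A ε^κ` times a constant depending only on `κ` and `s` (`tendsto_edgeInt_of_lt_two`), which an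
explicit primitive reduces to a beta integral (`edgeConst_eq`). If `κ > 2`, `u^(κ-3)` is integrable
at `0`, and dividing by `ε^2` leaves the Fisher integrand (`tendsto_edgeInt_of_two_lt`). If `κ = 2`,
all logarithmic scales between `ε` and `1` contribute equally. With `u = ε^τ` the limiting integrand
is constant for `0 < τ < 1` and zero elsewhere (`tendsto_edgeInt_of_eq_two`).

Uniformity in `s` comes from proving joint limits in `(ε, s)` at each `s₀ ∈ [0, 1]` and using
compactness. When `κ₁ < κ₂`, the right endpoint obeys the bounds for `κ₁` with coefficient `0` if
`κ₁ < 2`; if `κ₁ = 2` it is `O(ε^2)`, which the logarithm beats. -/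

/-! ### The gap between arithmetic and geometric means -/

/-- The gap between the weighted arithmetic and geometric means of `p` and `q`. -/
noncomputable def amgmGap (s p q : ℝ) : ℝ := s * p + (1 - s) * q - p ^ s * q ^ (1 - s)

lemma amgmGap_nonneg {s p q : ℝ} (hs : s ∈ Icc (0 : ℝ) 1) (hp : 0 ≤ p) (hq : 0 ≤ q) :
    0 ≤ amgmGap s p q := by
  have := Real.geom_mean_le_arith_mean2_weighted hs.1 (sub_nonneg.2 hs.2) hp hq (by ring)
  unfold amgmGap; linarith

lemma amgmGap_le_add {s p q : ℝ} (hs : s ∈ Icc (0 : ℝ) 1) (hp : 0 ≤ p) (hq : 0 ≤ q) :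
    amgmGap s p q ≤ p + q := by
  have h : 0 ≤ p ^ s * q ^ (1 - s) := by positivity
  have h1 : s * p ≤ p := mul_le_of_le_one_left hp hs.2
  have h2 : (1 - s) * q ≤ q := mul_le_of_le_one_left hq (by linarith [hs.1])
  unfold amgmGap; linarith

/-- Reflecting the line exchanges the roles of the density and its shift; this symmetry is why the
right endpoint enters with weight `1 - s`. -/
lemma amgmGap_symm (s p q : ℝ) : amgmGap (1 - s) q p = amgmGap s p q := by
  unfold amgmGap
  rw [sub_sub_cancel]; ring

lemma amgmGap_zero_right {s : ℝ} (hs : s ≠ 1) (p : ℝ) : amgmGap s p 0 = s * p := by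
  unfold amgmGap
  rw [Real.zero_rpow (sub_ne_zero.2 hs.symm)]; ring

lemma amgmGap_const_mul {s c p q : ℝ} (hc : 0 < c) (hp : 0 ≤ p) (hq : 0 ≤ q) :
    amgmGap s (c * p) (c * q) = c * amgmGap s p q := by
  unfold amgmGap
  rw [Real.mul_rpow hc.le hp, Real.mul_rpow hc.le hq]
  have : c ^ s * c ^ (1 - s) = c := by rw [← Real.rpow_add hc]; simp
  linear_combination (-p ^ s * q ^ (1 - s)) * this

/-- Comparing the geometric mean with the harmonic mean. -/
lemma amgmGap_le_sq_div {s p q : ℝ} (hs : s ∈ Icc (0 : ℝ) 1) (hp : 0 < p) (hq : 0 < q) :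
    amgmGap s p q ≤ (p - q) ^ 2 / min p q := by
  have hs0 := hs.1
  have hs1 : 0 ≤ 1 - s := sub_nonneg.2 hs.2
  have hm : 0 < min p q := lt_min hp hq
  have hD : min p q ≤ s * q + (1 - s) * p := by
    nlinarith [mul_le_mul_of_nonneg_left (min_le_right p q) hs0,
      mul_le_mul_of_nonneg_left (min_le_left p q) hs1]
  have hD0 : 0 < s * q + (1 - s) * p := hm.trans_le hD
  have hG : 0 < p ^ s * q ^ (1 - s) := by positivity
  have hinv := Real.geom_mean_le_arith_mean2_weighted hs0 hs1 (inv_pos.2 hp).le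
    (inv_pos.2 hq).le (by ring)
  rw [Real.inv_rpow hp.le, Real.inv_rpow hq.le, ← mul_inv] at hinv
  -- AM-GM for the inverses: the weighted harmonic mean is `p q / (s q + (1 - s) p)`.
  have h1 : p * q ≤ (s * q + (1 - s) * p) * (p ^ s * q ^ (1 - s)) := by
    have h2 := mul_le_mul_of_nonneg_left hinv (mul_pos (mul_pos hp hq) hG).le
    have h3 : p * q * (p ^ s * q ^ (1 - s)) * (p ^ s * q ^ (1 - s))⁻¹ = p * q := by
      field_simp
    have h4 : p * q * (p ^ s * q ^ (1 - s)) * (s * p⁻¹ + (1 - s) * q⁻¹) =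
      (s * q + (1 - s) * p) * (p ^ s * q ^ (1 - s)) := by field_simp
    rwa [h3, h4] at h2
  -- Uses `(s p + (1 - s) q) (s q + (1 - s) p) = p q + s (1 - s) (p - q)^2`; the product `p q` is
  -- absorbed by `h1`.
  have h5 : amgmGap s p q * (s * q + (1 - s) * p) ≤ (p - q) ^ 2 := by
    have h6 : s * (1 - s) * (p - q) ^ 2 ≤ 1 * (p - q) ^ 2 :=
      mul_le_mul_of_nonneg_right (by nlinarith) (sq_nonneg _)
    unfold amgmGap
    nlinarith
  calc amgmGap s p q ≤ (p - q) ^ 2 / (s * q + (1 - s) * p) := by rwa [le_div_iff₀ hD0]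
    _ ≤ _ := div_le_div_of_nonneg_left (sq_nonneg _) hm hD

lemma measurable_amgmGap {α : Type*} [MeasurableSpace α] {s : ℝ} {p q : α → ℝ}
    (hp : Measurable p) (hq : Measurable q) : Measurable fun x => amgmGap s (p x) (q x) := by
  unfold amgmGap; fun_prop

/-! ### Second order expansion of the gap -/

/-- The second order remainder quotient of the exponential function. -/
noncomputable def expQuot (v : ℝ) : ℝ := if v = 0 then 1 / 2 else (Real.exp v - 1 - v) / v ^ 2

lemma exp_eq_expQuot (v : ℝ) : Real.exp v = 1 + v + v ^ 2 * expQuot v := by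
  unfold expQuot
  split_ifs with h
  · simp [h]
  · field_simp; ring

lemma tendsto_expQuot : Tendsto expQuot (𝓝 0) (𝓝 (1 / 2)) := by
  have hb : ∀ v : ℝ, |v| ≤ 1 → |expQuot v - 1 / 2| ≤ |v| := by
    intro v hv
    unfold expQuot
    split_ifs with h
    · simp
    · have := Real.exp_bound hv (n := 3) (by norm_num)
      simp [Finset.sum_range_succ, Nat.factorial] at this
      have hv2 : 0 < v ^ 2 := by positivity
      have e : (Real.exp v - 1 - v) / v ^ 2 - 1 / 2 =
        (Real.exp v - (1 + v + v ^ 2 / 2)) / v ^ 2 := by field_simp; ring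
      rw [e, abs_div, abs_of_pos hv2, div_le_iff₀ hv2]
      refine this.trans ?_
      have : |v| ^ 3 = |v| * v ^ 2 := by rw [← sq_abs v]; ring
      rw [this]
      have : 0 ≤ |v| * v ^ 2 := by positivity
      nlinarith
  rw [tendsto_iff_norm_sub_tendsto_zero]
  refine squeeze_zero' (Eventually.of_forall fun _ => norm_nonneg _)
    (?_ : ∀ᶠ v in 𝓝 (0 : ℝ), _ ≤ |v|) ?_
  · filter_upwards [Metric.ball_mem_nhds (0 : ℝ) one_pos] with v hv
    exact hb v (by simpa using (le_of_lt (by simpa using hv : |v| < 1)))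
  · simpa using (continuous_abs.tendsto (0 : ℝ))

/-- With `v = log p - log q` the gap is `q (s e^v + 1 - s - e^(s v))`. Constant and linear terms
cancel, leaving only second order remainders. -/
lemma amgmGap_eq_expQuot {s p q : ℝ} (hp : 0 < p) (hq : 0 < q) :
    amgmGap s p q = q * (Real.log p - Real.log q) ^ 2 *
      (s * expQuot (Real.log p - Real.log q) -
        s ^ 2 * expQuot (s * (Real.log p - Real.log q))) := by
  set v := Real.log p - Real.log q with hv
  have hp' : p = q * Real.exp v := by
    rw [hv, Real.exp_sub, Real.exp_log hp, Real.exp_log hq]; field_simp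
  have hps : p ^ s * q ^ (1 - s) = q * Real.exp (s * v) := by
    rw [Real.rpow_def_of_pos hp, Real.rpow_def_of_pos hq, ← Real.exp_add]
    conv_rhs => rw [← Real.exp_log hq]
    rw [← Real.exp_add, hv]; ring_nf
  unfold amgmGap
  rw [hps, exp_eq_expQuot (s * v)]
  nth_rewrite 1 [hp']
  rw [exp_eq_expQuot v]; ring

/-- The gap of nearly equal arguments is to leading order `s (1 - s) / 2 * q * (log p - log q) ^ 2`. -/
lemma tendsto_amgmGap_of_log {ι : Type*} {l : Filter ι} {c s p q : ι → ℝ} {s₀ J : ℝ}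
    (hs : Tendsto s l (𝓝 s₀)) (hp : ∀ᶠ i in l, 0 < p i) (hq : ∀ᶠ i in l, 0 < q i)
    (hv : Tendsto (fun i => Real.log (p i) - Real.log (q i)) l (𝓝 0))
    (hJ : Tendsto (fun i => c i * (q i * (Real.log (p i) - Real.log (q i)) ^ 2)) l (𝓝 J)) :
    Tendsto (fun i => c i * amgmGap (s i) (p i) (q i)) l (𝓝 (J * (s₀ * (1 - s₀) / 2))) := by
  have h1 := tendsto_expQuot.comp hv
  have h2 : Tendsto (fun i => s i * (Real.log (p i) - Real.log (q i))) l (𝓝 0) := by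
    simpa using hs.mul hv
  have h3 := hJ.mul ((hs.mul h1).sub ((hs.pow 2).mul (tendsto_expQuot.comp h2)))
  have e : s₀ * (1 / 2) - s₀ ^ 2 * (1 / 2) = s₀ * (1 - s₀) / 2 := by ring
  rw [e] at h3
  refine h3.congr' ?_
  filter_upwards [hp, hq] with i hpi hqi
  rw [amgmGap_eq_expQuot hpi hqi]
  simp only [Function.comp_apply]; ring

/-! ### Bounds for one-sided profiles -/

lemma rpow_le_two_rpow_abs_mul {x y : ℝ} (a : ℝ) (hx : 0 < x) (hy : 0 < y) (hxy : x ≤ 2 * y)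
    (hyx : y ≤ 2 * x) : x ^ a ≤ 2 ^ |a| * y ^ a := by
  rcases le_total 0 a with ha | ha
  · rw [abs_of_nonneg ha, ← Real.mul_rpow (by norm_num) hy.le]
    exact Real.rpow_le_rpow hx.le hxy ha
  · have h2 : (2 : ℝ) ^ (-a) * y ^ a = (y / 2) ^ a := by
      rw [Real.div_rpow hy.le (by norm_num), Real.rpow_neg (by norm_num)]
      field_simp
    rw [abs_of_nonpos ha, h2]
    exact Real.rpow_le_rpow_of_nonpos (by positivity) (by linarith) ha

/-- For a function comparable to `u ^ (κ - 1)` with derivative `O(u ^ (κ - 2))`, the gap between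
its values at `u` and `u - ε` is `O(ε ^ 2 * u ^ (κ - 3))`. -/
lemma amgmGap_shift_le {h : ℝ → ℝ} {κ c C R : ℝ} (hc : 0 < c)
    (hd : ∀ u ∈ Ioo 0 R, DifferentiableAt ℝ h u)
    (hl : ∀ u ∈ Ioo 0 R, c * u ^ (κ - 1) ≤ h u)
    (hC : ∀ u ∈ Ioo 0 R, |deriv h u| ≤ C * u ^ (κ - 2))
    {s ε u : ℝ} (hs : s ∈ Icc (0 : ℝ) 1) (hε : 0 < ε) (hεu : 2 * ε ≤ u) (hu : u < R) :
    amgmGap s (h u) (h (u - ε)) ≤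
      (C * 2 ^ |κ - 2|) ^ 2 * 2 ^ |κ - 1| / c * (ε ^ 2 * u ^ (κ - 3)) := by
  have hu0 : 0 < u := by linarith
  have hC0 : 0 ≤ C := by
    have := (abs_nonneg _).trans (hC u ⟨hu0, hu⟩)
    exact nonneg_of_mul_nonneg_left this (by positivity)
  -- Because `2 ε ≤ u`, the interval `[u - ε, u]` lies in `[u / 2, u]`, so powers on it are
  -- comparable to those at `u`.
  have hmem : ∀ ξ ∈ Icc (u - ε) u, ξ ∈ Ioo 0 R := fun ξ hξ =>
    ⟨by linarith [hξ.1], by linarith [hξ.2]⟩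
  have hlow : ∀ ξ ∈ Icc (u - ε) u, c / 2 ^ |κ - 1| * u ^ (κ - 1) ≤ h ξ := by
    intro ξ hξ
    have h1 := rpow_le_two_rpow_abs_mul (κ - 1) hu0 (hmem ξ hξ).1 (by linarith [hξ.1])
      (by linarith [hξ.2])
    refine le_trans ?_ (hl ξ (hmem ξ hξ))
    rw [div_mul_eq_mul_div, div_le_iff₀ (by positivity)]
    nlinarith
  have hdiff : |h u - h (u - ε)| ≤ C * 2 ^ |κ - 2| * u ^ (κ - 2) * ε := by
    have := (convex_Icc (u - ε) u).norm_image_sub_le_of_norm_deriv_le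
      (f := h) (C := C * 2 ^ |κ - 2| * u ^ (κ - 2)) (fun ξ hξ => hd ξ (hmem ξ hξ)) (fun ξ hξ => by
        have h1 := rpow_le_two_rpow_abs_mul (κ - 2) (hmem ξ hξ).1 hu0 (by linarith [hξ.2])
          (by linarith [hξ.1])
        refine (hC ξ (hmem ξ hξ)).trans ?_
        rw [mul_assoc]
        exact mul_le_mul_of_nonneg_left h1 hC0)
      (left_mem_Icc.2 (by linarith)) (right_mem_Icc.2 (by linarith))
    simpa [abs_of_pos hε] using this
  have hm : c / 2 ^ |κ - 1| * u ^ (κ - 1) ≤ min (h u) (h (u - ε)) :=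
    le_min (hlow u (right_mem_Icc.2 (by linarith))) (hlow _ (left_mem_Icc.2 (by linarith)))
  have hm0 : 0 < c / 2 ^ |κ - 1| * u ^ (κ - 1) := by positivity
  refine (amgmGap_le_sq_div hs (hm0.trans_le (hm.trans (min_le_left _ _)))
    (hm0.trans_le (hm.trans (min_le_right _ _)))).trans ?_
  calc (h u - h (u - ε)) ^ 2 / min (h u) (h (u - ε))
      ≤ (C * 2 ^ |κ - 2| * u ^ (κ - 2) * ε) ^ 2 / (c / 2 ^ |κ - 1| * u ^ (κ - 1)) := by
        refine div_le_div₀ (by positivity) ?_ hm0 hm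
        rw [← sq_abs]
        exact pow_le_pow_left₀ (abs_nonneg _) hdiff 2
    _ = _ := by
        have e : u ^ (κ - 2) * u ^ (κ - 2) = u ^ (κ - 1) * u ^ (κ - 3) := by
          rw [← Real.rpow_add hu0, ← Real.rpow_add hu0]; ring_nf
        rw [div_eq_iff hm0.ne']
        field_simp
        linear_combination C ^ 2 * e

/-- A function on the line vanishing on `(-∞, 0]` whose growth and shift gaps on `(0, R)` are at
most those of a multiple of `u ^ (κ - 1)`. -/
structure EdgeBound (h : ℝ → ℝ) (κ R : ℝ) : Prop where
  measurable : Measurable h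
  nonneg : ∀ u, 0 ≤ h u
  zero : ∀ u ≤ 0, h u = 0
  bound : ∃ C, 0 ≤ C ∧ (∀ u ∈ Ioo 0 R, h u ≤ C * u ^ (κ - 1)) ∧
    ∀ s ∈ Icc (0 : ℝ) 1, ∀ ε u, 0 < ε → 2 * ε ≤ u → u < R →
      amgmGap s (h u) (h (u - ε)) ≤ C * (ε ^ 2 * u ^ (κ - 3))

/-- The contribution of one endpoint to the total gap. -/
noncomputable def edgeInt (h : ℝ → ℝ) (L ε s : ℝ) : ℝ :=
  ∫ u in Ioc 0 ((L + ε) / 2), amgmGap s (h u) (h (u - ε))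

/-- The gap between `x ^ (κ - 1)` and its unit shift, both extended by zero. -/
noncomputable def edgeKernel (κ s x : ℝ) : ℝ :=
  if x ≤ 1 then s * x ^ (κ - 1) else amgmGap s (x ^ (κ - 1)) ((x - 1) ^ (κ - 1))

noncomputable def edgeConst (κ s : ℝ) : ℝ := ∫ x in Ioi 0, edgeKernel κ s x

/-- An integrable majorant, up to constants, of the kernel. -/
noncomputable def edgeMajorant (κ x : ℝ) : ℝ :=
  (Ioc 0 2).indicator (fun x => x ^ (κ - 1)) x +
    (Ioc 1 2).indicator (fun x => (x - 1) ^ (κ - 1)) x +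
    (Ioi 2).indicator (fun x => x ^ (κ - 3)) x

lemma integrable_edgeMajorant {κ : ℝ} (h0 : 0 < κ) (h2 : κ < 2) : Integrable (edgeMajorant κ) := by
  have i0 : ∀ a b : ℝ, IntervalIntegrable (fun x : ℝ => x ^ (κ - 1)) volume a b := fun a b =>
    intervalIntegral.intervalIntegrable_rpow' (by linarith)
  have i1 : IntegrableOn (fun x : ℝ => (x - 1) ^ (κ - 1)) (Ioc 1 2) := by
    have := (i0 0 1).comp_sub_right 1
    norm_num at this
    rwa [intervalIntegrable_iff_integrableOn_Ioc_of_le (by norm_num)] at this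
  have i2 : IntegrableOn (fun x : ℝ => x ^ (κ - 1)) (Ioc 0 2) := by
    have := i0 0 2
    rwa [intervalIntegrable_iff_integrableOn_Ioc_of_le (by norm_num)] at this
  have i3 : IntegrableOn (fun x : ℝ => x ^ (κ - 3)) (Ioi 2) :=
    integrableOn_Ioi_rpow_of_lt (by linarith) (by norm_num)
  exact ((i2.integrable_indicator measurableSet_Ioc).add
    (i1.integrable_indicator measurableSet_Ioc)).add (i3.integrable_indicator measurableSet_Ioi)

/-- The factor `ε^(1-κ)` cancels every power of `ε`. For `x ≤ 2` the crude bound `p + q` and the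
growth bound suffice; for `x > 2` the quadratic shift bound gives the decay `x^(κ-3)`. -/
lemma EdgeBound.scaled_le {h : ℝ → ℝ} {κ R : ℝ} (hb : EdgeBound h κ R) :
    ∃ C, 0 ≤ C ∧ ∀ s ∈ Icc (0 : ℝ) 1, ∀ ε x, 0 < ε → 0 < x → ε * x < R →
      ε ^ (1 - κ) * amgmGap s (h (ε * x)) (h (ε * x - ε)) ≤ C * edgeMajorant κ x := by
  obtain ⟨C, hC, hC1, hC2⟩ := hb.bound
  refine ⟨C, hC, fun s hs ε x hε hx hR => ?_⟩
  have hscale : ∀ y, 0 < y → ε * y < R → ε ^ (1 - κ) * h (ε * y) ≤ C * y ^ (κ - 1) := by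
    intro y hy hyR
    have := mul_le_mul_of_nonneg_left (hC1 (ε * y) ⟨by positivity, hyR⟩)
      (Real.rpow_nonneg hε.le (1 - κ))
    refine this.trans_eq ?_
    rw [Real.mul_rpow hε.le hy.le]
    have e : ε ^ (1 - κ) * ε ^ (κ - 1) = 1 := by rw [← Real.rpow_add hε]; simp
    linear_combination (C * y ^ (κ - 1)) * e
  have m1 : 0 ≤ (Ioc (1 : ℝ) 2).indicator (fun x => (x - 1) ^ (κ - 1)) x :=
    indicator_nonneg (fun y hy => Real.rpow_nonneg (by linarith [hy.1]) _) _
  unfold edgeMajorant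
  rcases le_or_gt x 2 with h2 | h2
  · have n1 : x ∉ Ioi (2 : ℝ) := by simpa using h2
    rw [indicator_of_mem (show x ∈ Ioc (0 : ℝ) 2 from ⟨hx, h2⟩), indicator_of_notMem n1]
    have hgap := mul_le_mul_of_nonneg_left (amgmGap_le_add hs (hb.nonneg (ε * x))
      (hb.nonneg (ε * x - ε))) (Real.rpow_nonneg hε.le (1 - κ))
    have h3 := hscale x hx hR
    rcases le_or_gt x 1 with h1 | h1
    · have : h (ε * x - ε) = 0 := hb.zero _ (by nlinarith)
      rw [this] at hgap ⊢
      nlinarith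
    · rw [indicator_of_mem (show x ∈ Ioc (1 : ℝ) 2 from ⟨h1, h2⟩)]
      have h4 := hscale (x - 1) (by linarith) (by nlinarith)
      rw [show ε * (x - 1) = ε * x - ε by ring] at h4
      nlinarith
  · have n0 : x ∉ Ioc (0 : ℝ) 2 := fun h => absurd h.2 (not_le.2 h2)
    have n1 : x ∉ Ioc (1 : ℝ) 2 := fun h => absurd h.2 (not_le.2 h2)
    rw [indicator_of_notMem n0, indicator_of_notMem n1,
      indicator_of_mem (show x ∈ Ioi (2 : ℝ) from h2), zero_add, zero_add]
    refine (mul_le_mul_of_nonneg_left (hC2 s hs ε (ε * x) hε (by nlinarith) hR)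
      (Real.rpow_nonneg hε.le (1 - κ))).trans_eq ?_
    rw [Real.mul_rpow hε.le hx.le]
    have e : ε ^ (1 - κ) * (ε ^ 2 * ε ^ (κ - 3)) = 1 := by
      rw [← Real.rpow_natCast ε 2, ← Real.rpow_add hε, ← Real.rpow_add hε,
        show 1 - κ + (((2 : ℕ) : ℝ) + (κ - 3)) = 0 by push_cast; ring, Real.rpow_zero]
    linear_combination (C * x ^ (κ - 3)) * e

/-! ### Scaling limit at an endpoint with exponent below two -/

lemma continuousAt_amgmGap {ι : Type*} {l : Filter ι} {s p q : ι → ℝ} {s₀ p₀ q₀ : ℝ}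
    (hs : Tendsto s l (𝓝 s₀)) (hp : Tendsto p l (𝓝 p₀)) (hq : Tendsto q l (𝓝 q₀))
    (hp₀ : 0 < p₀) (hq₀ : 0 < q₀) :
    Tendsto (fun i => amgmGap (s i) (p i) (q i)) l (𝓝 (amgmGap s₀ p₀ q₀)) := by
  unfold amgmGap
  have hs' : Tendsto (fun i => 1 - s i) l (𝓝 (1 - s₀)) := hs.const_sub 1
  exact ((hs.mul hp).add (hs'.mul hq)).sub
    ((hp.rpow hs (Or.inl hp₀.ne')).mul (hq.rpow hs' (Or.inl hq₀.ne')))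

lemma eventually_fst_pos {s₀ : ℝ} :
    ∀ᶠ z : ℝ × ℝ in 𝓝[>] 0 ×ˢ 𝓝[Ioo 0 1] s₀, 0 < z.1 :=
  tendsto_fst.eventually self_mem_nhdsWithin

lemma eventually_fst_lt {s₀ δ : ℝ} (hδ : 0 < δ) :
    ∀ᶠ z : ℝ × ℝ in 𝓝[>] 0 ×ˢ 𝓝[Ioo 0 1] s₀, z.1 < δ :=
  tendsto_fst.eventually (mem_nhdsWithin_of_mem_nhds (Iio_mem_nhds hδ))

lemma eventually_snd_mem {s₀ : ℝ} :
    ∀ᶠ z : ℝ × ℝ in 𝓝[>] 0 ×ˢ 𝓝[Ioo 0 1] s₀, z.2 ∈ Ioo (0 : ℝ) 1 :=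
  tendsto_snd.eventually self_mem_nhdsWithin

lemma tendsto_fst_nhds {s₀ : ℝ} :
    Tendsto (fun z : ℝ × ℝ => z.1) (𝓝[>] 0 ×ˢ 𝓝[Ioo 0 1] s₀) (𝓝 0) :=
  tendsto_fst.mono_right nhdsWithin_le_nhds

lemma tendsto_snd_nhds {s₀ : ℝ} :
    Tendsto (fun z : ℝ × ℝ => z.2) (𝓝[>] 0 ×ˢ 𝓝[Ioo 0 1] s₀) (𝓝 s₀) :=
  tendsto_snd.mono_right nhdsWithin_le_nhds

lemma tendsto_scaled_of_tendsto_div_rpow {h : ℝ → ℝ} {κ A : ℝ} {ι : Type*} {l : Filter ι}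
    {ε : ι → ℝ} (hlim : Tendsto (fun u => h u / u ^ (κ - 1)) (𝓝[>] 0) (𝓝 A))
    (hε : Tendsto ε l (𝓝[>] 0)) {x : ℝ} (hx : 0 < x) :
    Tendsto (fun i => ε i ^ (1 - κ) * h (ε i * x)) l (𝓝 (A * x ^ (κ - 1))) := by
  have hpos : ∀ᶠ i in l, 0 < ε i := hε.eventually self_mem_nhdsWithin
  have h1 : Tendsto (fun i => ε i * x) l (𝓝[>] 0) := by
    refine tendsto_nhdsWithin_iff.2 ⟨?_, ?_⟩
    · simpa using (hε.mono_right nhdsWithin_le_nhds).mul_const x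
    · filter_upwards [hpos] with i hi using mul_pos hi hx
  refine ((hlim.comp h1).mul_const (x ^ (κ - 1))).congr' ?_
  filter_upwards [hpos] with i hi
  simp only [Function.comp_apply]
  rw [Real.mul_rpow hi.le hx.le]
  have e : ε i ^ (1 - κ) * ε i ^ (κ - 1) = 1 := by rw [← Real.rpow_add hi]; simp
  have := Real.rpow_pos_of_pos hi (κ - 1)
  field_simp
  linear_combination -h (ε i * x) * e

/-- Homogeneity moves `ε^(1-κ)` inside the gap, where both arguments converge to powers. The case `A
= 0` is allowed so that the endpoint with the larger exponent is covered too. -/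
lemma tendsto_scaled_gap {h : ℝ → ℝ} {κ A R s₀ : ℝ} (hb : EdgeBound h κ R) (hA : 0 ≤ A)
    (hlim : Tendsto (fun u => h u / u ^ (κ - 1)) (𝓝[>] 0) (𝓝 A)) {x : ℝ} (hx : 0 < x)
    (hx1 : x ≠ 1) :
    Tendsto (fun z : ℝ × ℝ => z.1 ^ (1 - κ) * amgmGap z.2 (h (z.1 * x)) (h (z.1 * x - z.1)))
      (𝓝[>] 0 ×ˢ 𝓝[Ioo 0 1] s₀) (𝓝 (A * edgeKernel κ s₀ x)) := by
  have hp := tendsto_scaled_of_tendsto_div_rpow hlim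
    (tendsto_fst (f := 𝓝[>] (0 : ℝ)) (g := 𝓝[Ioo 0 1] s₀)) hx
  unfold edgeKernel
  rcases lt_or_gt_of_ne hx1 with h1 | h1
  · rw [if_pos h1.le]
    have := (tendsto_snd_nhds (s₀ := s₀)).mul hp
    rw [show s₀ * (A * x ^ (κ - 1)) = A * (s₀ * x ^ (κ - 1)) by ring] at this
    refine this.congr' ?_
    filter_upwards [eventually_fst_pos, eventually_snd_mem] with z hz hs
    rw [hb.zero (z.1 * x - z.1) (by nlinarith), amgmGap_zero_right hs.2.ne]; ring
  · rw [if_neg (not_le.2 h1)]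
    have hx1' : 0 < x - 1 := by linarith
    have hq := tendsto_scaled_of_tendsto_div_rpow hlim
      (tendsto_fst (f := 𝓝[>] (0 : ℝ)) (g := 𝓝[Ioo 0 1] s₀)) hx1'
    have e : ∀ᶠ z : ℝ × ℝ in 𝓝[>] 0 ×ˢ 𝓝[Ioo 0 1] s₀,
        amgmGap z.2 (z.1 ^ (1 - κ) * h (z.1 * x)) (z.1 ^ (1 - κ) * h (z.1 * (x - 1))) =
        z.1 ^ (1 - κ) * amgmGap z.2 (h (z.1 * x)) (h (z.1 * x - z.1)) := by
      filter_upwards [eventually_fst_pos] with z hz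
      rw [amgmGap_const_mul (Real.rpow_pos_of_pos hz _) (hb.nonneg _) (hb.nonneg _), mul_sub,
        mul_one]
    refine Tendsto.congr' e ?_
    -- For `A = 0` both arguments tend to `0`, outside the reach of `continuousAt_amgmGap`, so the
    -- bound `p + q` squeezes instead.
    rcases hA.eq_or_lt with rfl | hA
    · simp only [zero_mul] at hp hq ⊢
      have hsum := hp.add hq
      rw [add_zero] at hsum
      refine squeeze_zero' ?_ ?_ hsum
      · filter_upwards [eventually_fst_pos, eventually_snd_mem] with z hz hs
        exact amgmGap_nonneg (Ioo_subset_Icc_self hs)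
          (mul_nonneg (Real.rpow_nonneg hz.le _) (hb.nonneg _))
          (mul_nonneg (Real.rpow_nonneg hz.le _) (hb.nonneg _))
      · filter_upwards [eventually_fst_pos, eventually_snd_mem] with z hz hs
        exact amgmGap_le_add (Ioo_subset_Icc_self hs)
          (mul_nonneg (Real.rpow_nonneg hz.le _) (hb.nonneg _))
          (mul_nonneg (Real.rpow_nonneg hz.le _) (hb.nonneg _))
    · rw [← amgmGap_const_mul hA (by positivity) (by positivity)]
      exact continuousAt_amgmGap tendsto_snd_nhds hp hq (by positivity) (by positivity)

/-- The substitution `u = ε x`. The moving upper limit becomes an indicator, so that dominated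
convergence runs on a fixed domain. -/
lemma edgeInt_div_rpow_eq {h : ℝ → ℝ} {κ L ε s : ℝ} (hL : 0 < L) (hε : 0 < ε) :
    edgeInt h L ε s / ε ^ κ = ∫ x in Ioi 0, (Ioc 0 ((L + ε) / 2 / ε)).indicator
      (fun x => ε ^ (1 - κ) * amgmGap s (h (ε * x)) (h (ε * x - ε))) x := by
  have hU : 0 ≤ (L + ε) / 2 / ε := by positivity
  rw [setIntegral_indicator measurableSet_Ioc, inter_eq_right.2 (fun x hx => hx.1),
    integral_const_mul, ← intervalIntegral.integral_of_le hU,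
    intervalIntegral.integral_comp_mul_left (fun u => amgmGap s (h u) (h (u - ε))) hε.ne',
    mul_zero, mul_div_cancel₀ _ hε.ne', intervalIntegral.integral_of_le (by positivity),
    Real.rpow_sub hε, Real.rpow_one, smul_eq_mul]
  unfold edgeInt
  field_simp

/-- Leading order of the contribution of an endpoint with exponent below `2`. -/
lemma tendsto_edgeInt_of_lt_two {h : ℝ → ℝ} {κ A L R s₀ : ℝ} (h0 : 0 < κ) (h2 : κ < 2)
    (hL : 0 < L) (hR : L / 2 < R) (hb : EdgeBound h κ R) (hA : 0 ≤ A)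
    (hlim : Tendsto (fun u => h u / u ^ (κ - 1)) (𝓝[>] 0) (𝓝 A)) :
    Tendsto (fun z : ℝ × ℝ => edgeInt h L z.1 z.2 / z.1 ^ κ)
      (𝓝[>] 0 ×ˢ 𝓝[Ioo 0 1] s₀) (𝓝 (A * edgeConst κ s₀)) := by
  obtain ⟨C, hC, hmaj⟩ := hb.scaled_le
  unfold edgeConst
  rw [← integral_const_mul]
  have key : Tendsto (fun z : ℝ × ℝ => ∫ x in Ioi 0, (Ioc 0 ((L + z.1) / 2 / z.1)).indicator
      (fun x => z.1 ^ (1 - κ) * amgmGap z.2 (h (z.1 * x)) (h (z.1 * x - z.1))) x)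
      (𝓝[>] 0 ×ˢ 𝓝[Ioo 0 1] s₀) (𝓝 (∫ x in Ioi 0, A * edgeKernel κ s₀ x)) := by
    refine tendsto_integral_filter_of_dominated_convergence (fun x => C * edgeMajorant κ x)
      ?_ ?_ ((integrable_edgeMajorant h0 h2).integrableOn.const_mul C) ?_
    · refine Eventually.of_forall fun z => Measurable.aestronglyMeasurable ?_
      refine Measurable.indicator ?_ measurableSet_Ioc
      exact (measurable_amgmGap (hb.measurable.comp (by fun_prop))
        (hb.measurable.comp (by fun_prop))).const_mul _
    -- The condition `ε < 2 R - L` keeps `(L + ε) / 2` below `R`, where the bounds hold.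
    · filter_upwards [eventually_fst_pos, eventually_snd_mem,
        eventually_fst_lt (show 0 < 2 * R - L by linarith)] with z hz hs hzR
      refine (ae_restrict_iff' measurableSet_Ioi).2 (Eventually.of_forall fun x hx => ?_)
      have hx0 : 0 < x := hx
      have hs' := Ioo_subset_Icc_self hs
      have hnn : 0 ≤ C * edgeMajorant κ x := by
        refine mul_nonneg hC (add_nonneg (add_nonneg ?_ ?_) ?_)
        · exact indicator_nonneg (fun y hy => Real.rpow_nonneg hy.1.le _) _
        · exact indicator_nonneg (fun y hy => Real.rpow_nonneg (by linarith [hy.1]) _) _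
        · exact indicator_nonneg (fun y hy => Real.rpow_nonneg (by linarith [mem_Ioi.1 hy]) _) _
      by_cases hm : x ∈ Ioc 0 ((L + z.1) / 2 / z.1)
      · rw [indicator_of_mem hm, Real.norm_of_nonneg (mul_nonneg (Real.rpow_nonneg hz.le _)
          (amgmGap_nonneg hs' (hb.nonneg _) (hb.nonneg _)))]
        refine hmaj z.2 hs' z.1 x hz hx0 ?_
        have := (le_div_iff₀ hz).1 hm.2
        nlinarith
      · rw [indicator_of_notMem hm, norm_zero]
        exact hnn
    · have hne : ∀ᵐ x : ℝ ∂(volume.restrict (Ioi 0)), x ≠ 1 :=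
        ae_restrict_of_ae (Measure.ae_ne volume 1)
      filter_upwards [hne, ae_restrict_mem measurableSet_Ioi] with x hx1 hx
      have hx0 : 0 < x := hx
      refine (tendsto_scaled_gap hb hA hlim hx0 hx1).congr' ?_
      filter_upwards [eventually_fst_pos,
        eventually_fst_lt (show 0 < L / (2 * x) by positivity)] with z hz hzx
      rw [indicator_of_mem]
      refine ⟨hx0, ?_⟩
      rw [le_div_iff₀ hz]
      rw [lt_div_iff₀ (by positivity)] at hzx
      nlinarith
  refine key.congr' ?_
  filter_upwards [eventually_fst_pos] with z hz
  rw [edgeInt_div_rpow_eq hL hz]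

lemma EdgeBound.of_deriv_bounds {h : ℝ → ℝ} {κ c C C' R : ℝ} (hm : Measurable h)
    (hn : ∀ u, 0 ≤ h u) (hz : ∀ u ≤ 0, h u = 0) (hc : 0 < c) (hC' : 0 ≤ C')
    (hd : ∀ u ∈ Ioo 0 R, DifferentiableAt ℝ h u)
    (hl : ∀ u ∈ Ioo 0 R, c * u ^ (κ - 1) ≤ h u)
    (hu : ∀ u ∈ Ioo 0 R, h u ≤ C' * u ^ (κ - 1))
    (hC : ∀ u ∈ Ioo 0 R, |deriv h u| ≤ C * u ^ (κ - 2)) : EdgeBound h κ R := by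
  refine ⟨hm, hn, hz, max C' ((C * 2 ^ |κ - 2|) ^ 2 * 2 ^ |κ - 1| / c), le_max_of_le_left hC',
    fun u hu' => (hu u hu').trans ?_, fun s hs ε u hε hεu huR =>
      (amgmGap_shift_le hc hd hl hC hs hε hεu huR).trans ?_⟩
  · exact mul_le_mul_of_nonneg_right (le_max_left _ _) (Real.rpow_nonneg hu'.1.le _)
  · exact mul_le_mul_of_nonneg_right (le_max_right _ _)
      (mul_nonneg (sq_nonneg _) (Real.rpow_nonneg (by linarith) _))

/-- The model profile: its scaled gaps converge to the kernel, so the profile bounds can be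
transferred to the kernel. -/
lemma edgeBound_rpow (κ : ℝ) : EdgeBound ((Ioi 0).indicator fun u => u ^ (κ - 1)) κ 1 := by
  have hder : ∀ u ∈ Ioo (0 : ℝ) 1, HasDerivAt ((Ioi 0).indicator fun u : ℝ => u ^ (κ - 1))
      ((κ - 1) * u ^ (κ - 1 - 1)) u := by
    intro u hu
    refine (Real.hasDerivAt_rpow_const (p := κ - 1) (Or.inl hu.1.ne')).congr_of_eventuallyEq ?_
    filter_upwards [Ioi_mem_nhds hu.1] with v hv
    rw [indicator_of_mem hv]
  refine EdgeBound.of_deriv_bounds (c := 1) (C' := 1) (C := |κ - 1|) ?_ ?_ ?_ one_pos zero_le_one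
    (fun u hu => (hder u hu).differentiableAt) ?_ ?_ ?_
  · exact (measurable_id.pow_const _).indicator measurableSet_Ioi
  · exact fun u => indicator_nonneg (fun v hv => Real.rpow_nonneg (le_of_lt hv) _) u
  · exact fun u hu => indicator_of_notMem (notMem_Ioi.2 hu) _
  · intro u hu
    rw [indicator_of_mem (show u ∈ Ioi 0 from hu.1), one_mul]
  · intro u hu
    rw [indicator_of_mem (show u ∈ Ioi 0 from hu.1), one_mul]
  · intro u hu
    rw [(hder u hu).deriv, abs_mul, abs_of_nonneg (Real.rpow_nonneg hu.1.le _)]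
    rw [show κ - 1 - 1 = κ - 2 by ring]

lemma edgeKernel_nonneg {κ s x : ℝ} (hs : s ∈ Icc (0 : ℝ) 1) (hx : 0 < x) :
    0 ≤ edgeKernel κ s x := by
  unfold edgeKernel
  split_ifs with h
  · exact mul_nonneg hs.1 (Real.rpow_nonneg hx.le _)
  · exact amgmGap_nonneg hs (Real.rpow_nonneg hx.le _) (Real.rpow_nonneg (by linarith) _)

/-- Away from `x = 1` the kernel is a limit of scaled gaps of the model profile, all dominated by
the same integrable majorant. -/
lemma integrableOn_edgeKernel {κ s : ℝ} (h0 : 0 < κ) (h2 : κ < 2) (hs : s ∈ Ioo (0 : ℝ) 1) :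
    IntegrableOn (edgeKernel κ s) (Ioi 0) := by
  have hb := edgeBound_rpow κ
  obtain ⟨C, hC, hmaj⟩ := hb.scaled_le
  have hlim : Tendsto (fun u : ℝ => (Ioi 0).indicator (fun u => u ^ (κ - 1)) u / u ^ (κ - 1))
      (𝓝[>] 0) (𝓝 1) := by
    refine tendsto_const_nhds.congr' ?_
    filter_upwards [self_mem_nhdsWithin] with u hu
    rw [indicator_of_mem hu, div_self (Real.rpow_pos_of_pos hu _).ne']
  have hmeas : Measurable (edgeKernel κ s) := by
    unfold edgeKernel
    exact Measurable.ite measurableSet_Iic (by fun_prop)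
      (measurable_amgmGap (by fun_prop) (by fun_prop))
  refine Integrable.mono' ((integrable_edgeMajorant h0 h2).integrableOn.const_mul C)
    hmeas.aestronglyMeasurable ?_
  filter_upwards [ae_restrict_of_ae (Measure.ae_ne volume 1),
    ae_restrict_mem measurableSet_Ioi] with x hx1 hx
  have hx0 : 0 < x := hx
  have : (𝓝[Ioo 0 1] s).NeBot :=
    mem_closure_iff_nhdsWithin_neBot.1 (subset_closure hs)
  rw [Real.norm_of_nonneg (edgeKernel_nonneg (Ioo_subset_Icc_self hs) hx0)]
  refine le_of_tendsto (f := fun z : ℝ × ℝ => _)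
    (by simpa using tendsto_scaled_gap (s₀ := s) hb zero_le_one hlim hx0 hx1) ?_
  filter_upwards [eventually_fst_pos, eventually_snd_mem,
    eventually_fst_lt (show 0 < 1 / x by positivity)] with z hz hzs hzx
  exact hmaj z.2 (Ioo_subset_Icc_self hzs) z.1 x hz hx0 (by rwa [lt_div_iff₀ hx0] at hzx)

/-! ### Beta integrals and the endpoint constant -/

lemma integrableOn_beta {a b : ℝ} (ha : 0 < a) (hb : 0 < b) :
    IntegrableOn (fun x : ℝ => x ^ (a - 1) * (1 - x) ^ (b - 1)) (Ioo 0 1) := by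
  have h := Complex.betaIntegral_convergent (u := a) (v := b) (by simpa) (by simpa)
  rw [intervalIntegrable_iff_integrableOn_Ioo_of_le zero_le_one] at h
  refine (integrableOn_congr_fun (fun x hx => ?_) measurableSet_Ioo).1 (Integrable.re h)
  norm_cast
  rw [← Complex.ofReal_cpow hx.1.le, ← Complex.ofReal_cpow (by linarith [hx.2])]
  simp [← Complex.ofReal_mul]

lemma integral_beta {a b : ℝ} (ha : 0 < a) (hb : 0 < b) :
    ∫ x in Ioo 0 1, x ^ (a - 1) * (1 - x) ^ (b - 1) = ProbabilityTheory.beta a b := by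
  have h := Complex.betaIntegral_convergent (u := a) (v := b) (by simpa) (by simpa)
  rw [intervalIntegrable_iff_integrableOn_Ioo_of_le zero_le_one] at h
  rw [ProbabilityTheory.beta_eq_betaIntegralReal a b ha hb, Complex.betaIntegral,
    intervalIntegral.integral_of_le zero_le_one, integral_Ioc_eq_integral_Ioo,
    ← RCLike.re_to_complex, ← integral_re h]
  refine setIntegral_congr_fun measurableSet_Ioo (fun x hx => ?_)
  norm_cast
  rw [← Complex.ofReal_cpow hx.1.le, ← Complex.ofReal_cpow (by linarith [hx.2])]
  simp [← Complex.ofReal_mul]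

lemma beta_integrand_inv {a b x : ℝ} (hx : 1 < x) :
    x ^ ((-1 : ℝ) - 1) * ((x ^ (-1 : ℝ)) ^ (a - 1) * (1 - x ^ (-1 : ℝ)) ^ (b - 1)) =
      x ^ (-(a + b)) * (x - 1) ^ (b - 1) := by
  have hx0 : 0 < x := by linarith
  have h1 : 1 - x ^ (-1 : ℝ) = (x - 1) * x ^ (-1 : ℝ) := by
    rw [Real.rpow_neg_one]; field_simp
  rw [h1, Real.mul_rpow (by linarith) (by positivity), ← Real.rpow_mul hx0.le,
    ← Real.rpow_mul hx0.le]
  have e : x ^ (-(a + b)) = x ^ ((-1 : ℝ) - 1) * x ^ (-1 * (a - 1)) * x ^ (-1 * (b - 1)) := by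
    rw [← Real.rpow_add hx0, ← Real.rpow_add hx0]; ring_nf
  rw [e]; ring

/-- The inversion `x ↦ 1 / x` carries `(0, 1)` onto `(1, ∞)`; the beta integrand is extended by zero
so that a substitution on the whole half-line applies. -/
lemma integral_Ioi_beta {a b : ℝ} (ha : 0 < a) (hb : 0 < b) :
    IntegrableOn (fun x : ℝ => x ^ (-(a + b)) * (x - 1) ^ (b - 1)) (Ioi 1) ∧
    ∫ x in Ioi 1, x ^ (-(a + b)) * (x - 1) ^ (b - 1) = ProbabilityTheory.beta a b := by
  set g : ℝ → ℝ := (Ioo 0 1).indicator fun x => x ^ (a - 1) * (1 - x) ^ (b - 1) with hg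
  have hgi : IntegrableOn g (Ioi 0) :=
    ((integrable_indicator_iff measurableSet_Ioo).2 (integrableOn_beta ha hb)).integrableOn
  have hgv : ∫ x in Ioi 0, g x = ProbabilityTheory.beta a b := by
    rw [hg, setIntegral_indicator measurableSet_Ioo, inter_eq_right.2 (fun x hx => hx.1),
      integral_beta ha hb]
  have hsub : EqOn (fun x => (|(-1 : ℝ)| * x ^ ((-1 : ℝ) - 1)) • g (x ^ (-1 : ℝ)))
      ((Ioi 1).indicator fun x : ℝ => x ^ (-(a + b)) * (x - 1) ^ (b - 1)) (Ioi 0) := by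
    intro x hx
    have hx0 : 0 < x := hx
    by_cases h1 : 1 < x
    · have hmem : x ^ (-1 : ℝ) ∈ Ioo (0 : ℝ) 1 :=
        ⟨by positivity, by rw [Real.rpow_neg_one]; exact inv_lt_one_of_one_lt₀ h1⟩
      simp only [hg]
      rw [indicator_of_mem hmem, indicator_of_mem (show x ∈ Ioi 1 from h1), abs_neg, abs_one,
        one_mul, smul_eq_mul, beta_integrand_inv h1]
    · have hmem : x ^ (-1 : ℝ) ∉ Ioo (0 : ℝ) 1 := by
        rw [Real.rpow_neg_one]
        exact fun h => absurd h.2 (not_lt.2 ((one_le_inv₀ hx0).2 (not_lt.1 h1)))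
      simp only [hg]
      rw [indicator_of_notMem hmem, indicator_of_notMem (show x ∉ Ioi 1 from h1), smul_zero]
  constructor
  · have h := (integrableOn_Ioi_comp_rpow_iff g (show (-1 : ℝ) ≠ 0 by norm_num)).2 hgi
    have h := (integrableOn_congr_fun hsub measurableSet_Ioi).1 h
    rw [IntegrableOn, integrable_indicator_iff measurableSet_Ioi, IntegrableOn,
      Measure.restrict_restrict measurableSet_Ioi,
      inter_eq_left.2 (Ioi_subset_Ioi zero_le_one)] at h
    exact h
  · rw [← hgv, ← integral_comp_rpow_Ioi g (show (-1 : ℝ) ≠ 0 by norm_num),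
      setIntegral_congr_fun measurableSet_Ioi hsub, setIntegral_indicator measurableSet_Ioi,
      inter_eq_right.2 (Ioi_subset_Ioi zero_le_one)]

/-- A primitive of the kernel minus a multiple of a beta integrand. -/
noncomputable def edgePrimitive (κ s x : ℝ) : ℝ :=
  (s * x ^ κ + (1 - s) * (x - 1) ^ κ - x ^ (s * (κ - 1)) * (x - 1) ^ (s + κ * (1 - s)) -
    s * (x ^ (s * (κ - 1) - 1) * (x - 1) ^ (s + κ * (1 - s)))) / κ

/-- Put `α = s (κ - 1)` and `β = s + κ (1 - s)`, so `α + β = κ`. The derivative of `x^α (x-1)^β` is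
`κ x^α (x-1)^(β-1) - α x^(α-1) (x-1)^(β-1)`, and the term `s x^(α-1) (x-1)^β` removes the error at
the cost of one in `x^(α-2) (x-1)^(β-1)`, which is integrable at infinity when `κ < 2`. -/
lemma hasDerivAt_edgePrimitive {κ s x : ℝ} (h0 : 0 < κ) (hx : 1 < x) :
    HasDerivAt (edgePrimitive κ s) (amgmGap s (x ^ (κ - 1)) ((x - 1) ^ (κ - 1)) -
      s * (1 - s * (κ - 1)) / κ *
        (x ^ (s * (κ - 1) - 2) * (x - 1) ^ (s + κ * (1 - s) - 1))) x := by
  have hx0 : 0 < x := by linarith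
  have hx1 : 0 < x - 1 := by linarith
  have d1 : ∀ p : ℝ, HasDerivAt (fun x : ℝ => x ^ p) (p * x ^ (p - 1)) x := fun p =>
    Real.hasDerivAt_rpow_const (Or.inl hx0.ne')
  have d2 : ∀ p : ℝ, HasDerivAt (fun x : ℝ => (x - 1) ^ p) (p * (x - 1) ^ (p - 1)) x := fun p => by
    simpa using ((hasDerivAt_id x).sub_const 1).rpow_const (p := p) (Or.inl hx1.ne')
  have D := (((((d1 κ).const_mul s).add ((d2 κ).const_mul (1 - s))).sub
    ((d1 (s * (κ - 1))).mul (d2 (s + κ * (1 - s))))).sub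
    (((d1 (s * (κ - 1) - 1)).mul (d2 (s + κ * (1 - s)))).const_mul s)).div_const κ
  refine HasDerivAt.congr_deriv (f := edgePrimitive κ s) D ?_
  unfold amgmGap
  rw [← Real.rpow_mul hx0.le, ← Real.rpow_mul hx1.le]
  have e1 : x ^ (s * (κ - 1) - 1) = x ^ (s * (κ - 1) - 2) * x := by
    rw [← Real.rpow_add_one hx0.ne']; ring_nf
  have e2 : x ^ (s * (κ - 1)) = x ^ (s * (κ - 1) - 2) * x * x := by
    rw [← Real.rpow_add_one hx0.ne', ← Real.rpow_add_one hx0.ne']; ring_nf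
  have e3 : (x - 1) ^ (s + κ * (1 - s)) = (x - 1) ^ (s + κ * (1 - s) - 1) * (x - 1) := by
    rw [← Real.rpow_add_one hx1.ne']; ring_nf
  have e4 : (x - 1) ^ ((κ - 1) * (1 - s)) = (x - 1) ^ (s + κ * (1 - s) - 1) := by ring_nf
  rw [show (κ - 1) * s = s * (κ - 1) by ring, show s * (κ - 1) - 1 - 1 = s * (κ - 1) - 2 by ring,
    e2, e1, e3, e4]
  field_simp
  ring

/-- In `y = 1 / x` the primitive is `Φ y / (κ y^κ)`, where `Φ` and its derivative both vanish at
`0`; since `κ < 2`, the quotient tends to `0`. -/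
lemma tendsto_edgePrimitive {κ s : ℝ} (h0 : 0 < κ) (h2 : κ < 2) :
    Tendsto (edgePrimitive κ s) atTop (𝓝 0) := by
  set β := s + κ * (1 - s) with hβ
  set Φ : ℝ → ℝ := fun y => s + (1 - s) * (1 - y) ^ κ - (1 - y) ^ β - s * (y * (1 - y) ^ β) with hΦ
  set Φ' : ℝ → ℝ := fun y => (1 - s) * (-1 * κ * (1 - y) ^ (κ - 1)) - -1 * β * (1 - y) ^ (β - 1) -
    s * (1 * (1 - y) ^ β + y * (-1 * β * (1 - y) ^ (β - 1))) with hΦ'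
  have d : ∀ p y : ℝ, y < 1 → HasDerivAt (fun y : ℝ => (1 - y) ^ p) (-1 * p * (1 - y) ^ (p - 1)) y :=
    fun p y hy => ((hasDerivAt_id y).const_sub 1).rpow_const (p := p)
      (Or.inl (sub_ne_zero.2 hy.ne'))
  have dΦ : ∀ y, y < 1 → HasDerivAt Φ (Φ' y) y := fun y hy =>
    ((((d κ y hy).const_mul (1 - s)).const_add s).sub (d β y hy)).sub
      (((hasDerivAt_id y).mul (d β y hy)).const_mul s)
  have dΦ' : DifferentiableAt ℝ Φ' 0 := by
    have dd := fun p => (d p 0 one_pos).differentiableAt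
    exact ((((dd _).const_mul _).const_mul _).sub ((dd _).const_mul _)).sub
      ((((dd _).const_mul _).add (differentiableAt_id.mul ((dd _).const_mul _))).const_mul _)
  have z0 : Φ 0 = 0 := by simp [hΦ]
  have z1 : Φ' 0 = 0 := by simp [hΦ', hβ]; ring
  have hpos : Tendsto (fun y : ℝ => y ^ (2 - κ)) (𝓝[>] 0) (𝓝 0) := by
    have := (Real.continuousAt_rpow_const 0 (2 - κ) (Or.inr (by linarith))).tendsto
    rw [Real.zero_rpow (by linarith)] at this
    exact this.mono_left nhdsWithin_le_nhds
  have hmain : Tendsto (fun y => Φ y / y ^ κ) (𝓝[>] 0) (𝓝 0) := by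
    refine HasDerivAt.lhopital_zero_nhdsGT (f' := Φ') (g' := fun y => κ * y ^ (κ - 1)) ?_ ?_ ?_ ?_ ?_ ?_
    · filter_upwards [mem_nhdsWithin_of_mem_nhds (Iio_mem_nhds one_pos)] with y hy using dΦ y hy
    · filter_upwards [self_mem_nhdsWithin] with y hy
      exact Real.hasDerivAt_rpow_const (Or.inl (ne_of_gt hy))
    · filter_upwards [self_mem_nhdsWithin] with y hy
      exact (mul_pos h0 (Real.rpow_pos_of_pos hy _)).ne'
    · have := (dΦ 0 one_pos).continuousAt.tendsto
      rw [z0] at this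
      exact this.mono_left nhdsWithin_le_nhds
    · have := (Real.continuousAt_rpow_const 0 κ (Or.inr h0.le)).tendsto
      rw [Real.zero_rpow h0.ne'] at this
      exact this.mono_left nhdsWithin_le_nhds
    -- `Φ' y / y` converges because `Φ' 0 = 0`, and the remaining factor `y^(2-κ) / κ` tends to `0`.
    · have hs := hasDerivAt_iff_tendsto_slope_zero.1 dΦ'.hasDerivAt
      have hs := (hs.mono_left (nhdsGT_le_nhdsNE 0)).mul (hpos.div_const κ)
      rw [zero_div, mul_zero] at hs
      refine hs.congr' ?_
      filter_upwards [self_mem_nhdsWithin] with y hy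
      have hy0 : 0 < y := hy
      rw [z1, zero_add, sub_zero, smul_eq_mul]
      have : y ^ (2 - κ) * y ^ (κ - 1) = y := by
        rw [← Real.rpow_add hy0]; ring_nf; simp
      have h3 := Real.rpow_pos_of_pos hy0 (κ - 1)
      field_simp
      linear_combination Φ' y * this
  have hinv := (hmain.comp tendsto_inv_atTop_nhdsGT_zero).div_const κ
  rw [zero_div] at hinv
  refine hinv.congr' ?_
  filter_upwards [eventually_gt_atTop 1] with x hx
  have hx0 : 0 < x := by linarith
  have hx1 : 0 < x - 1 := by linarith
  simp only [Function.comp_apply, hΦ]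
  unfold edgePrimitive
  rw [← hβ]
  have e : 1 - x⁻¹ = (x - 1) * x⁻¹ := by field_simp
  rw [e, Real.mul_rpow hx1.le (by positivity), Real.mul_rpow hx1.le (by positivity),
    Real.inv_rpow hx0.le, Real.inv_rpow hx0.le, div_inv_eq_mul]
  have e1 : x ^ (s * (κ - 1)) = x ^ κ * (x ^ β)⁻¹ := by
    rw [← Real.rpow_neg hx0.le, ← Real.rpow_add hx0, hβ]; ring_nf
  have e2 : x ^ (s * (κ - 1) - 1) = x ^ κ * (x ^ β)⁻¹ * x⁻¹ := by
    rw [Real.rpow_sub_one hx0.ne', e1, div_eq_mul_inv]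
  have := Real.rpow_pos_of_pos hx0 κ
  rw [e1, e2]
  field_simp

/-- Closed form of the endpoint constant. -/
lemma edgeConst_eq {κ s : ℝ} (h0 : 0 < κ) (h2 : κ < 2) (hs : s ∈ Ioo (0 : ℝ) 1) :
    edgeConst κ s =
      s * (1 - s * (κ - 1)) * ProbabilityTheory.beta (s + κ * (1 - s)) (2 - κ) / κ := by
  have hβ : 0 < s + κ * (1 - s) := by nlinarith [hs.1, hs.2]
  have hK := integrableOn_edgeKernel h0 h2 hs
  have hK1 := hK.mono_set (Ioc_subset_Ioi_self : Ioc (0 : ℝ) 1 ⊆ Ioi 0)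
  have hK2 := hK.mono_set (Ioi_subset_Ioi (zero_le_one' ℝ))
  have hG : EqOn (edgeKernel κ s) (fun x => amgmGap s (x ^ (κ - 1)) ((x - 1) ^ (κ - 1))) (Ioi 1) :=
    fun x hx => if_neg (not_le.2 hx)
  have hGi := (integrableOn_congr_fun hG measurableSet_Ioi).1 hK2
  obtain ⟨hBi, hB⟩ := integral_Ioi_beta (a := 2 - κ) (b := s + κ * (1 - s)) (by linarith) hβ
  rw [show -(2 - κ + (s + κ * (1 - s))) = s * (κ - 1) - 2 by ring] at hBi hB
  have hB' : ProbabilityTheory.beta (2 - κ) (s + κ * (1 - s)) =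
      ProbabilityTheory.beta (s + κ * (1 - s)) (2 - κ) := by
    unfold ProbabilityTheory.beta
    rw [mul_comm, add_comm (2 - κ)]
  have hint1 : ∫ x in Ioc 0 1, edgeKernel κ s x = s / κ := by
    have hI : EqOn (edgeKernel κ s) (fun x => s * x ^ (κ - 1)) (Ioc 0 1) :=
      fun x hx => if_pos hx.2
    rw [setIntegral_congr_fun measurableSet_Ioc hI, integral_const_mul,
      ← intervalIntegral.integral_of_le zero_le_one, integral_rpow (Or.inl (by linarith))]
    simp [Real.zero_rpow h0.ne']
    ring
  have hcont : ContinuousWithinAt (edgePrimitive κ s) (Ici 1) 1 := by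
    unfold edgePrimitive
    refine ContinuousAt.continuousWithinAt ?_
    have c1 : ∀ p : ℝ, ContinuousAt (fun x : ℝ => x ^ p) 1 := fun p =>
      Real.continuousAt_rpow_const 1 p (Or.inl one_ne_zero)
    have c2 : ∀ p : ℝ, 0 < p → ContinuousAt (fun x : ℝ => (x - 1) ^ p) 1 := fun p hp =>
      (continuousAt_id.sub continuousAt_const).rpow_const (Or.inr hp.le)
    exact ((((continuousAt_const.mul (c1 κ)).add (continuousAt_const.mul (c2 κ h0))).sub
      ((c1 _).mul (c2 _ hβ))).sub (continuousAt_const.mul ((c1 _).mul (c2 _ hβ)))).div_const κ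
  have hftc := integral_Ioi_of_hasDerivAt_of_tendsto hcont
    (fun x hx => hasDerivAt_edgePrimitive h0 hx)
    (hGi.sub (hBi.const_mul (s * (1 - s * (κ - 1)) / κ))) (tendsto_edgePrimitive h0 h2)
  -- The boundary term at `1` cancels the kernel's integral over `(0, 1]`, so only the beta term
  -- survives.
  have hF1 : edgePrimitive κ s 1 = s / κ := by
    simp [edgePrimitive, Real.zero_rpow h0.ne', Real.zero_rpow hβ.ne']
  rw [integral_sub hGi (hBi.const_mul _), integral_const_mul, hB, hB', hF1] at hftc
  unfold edgeConst
  rw [← Ioc_union_Ioi_eq_Ioi (zero_le_one' ℝ),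
    setIntegral_union Ioc_disjoint_Ioi_same measurableSet_Ioi hK1 hK2, hint1,
    setIntegral_congr_fun measurableSet_Ioi hG]
  linear_combination hftc

lemma edgeConst_one {s : ℝ} (hs : s ∈ Ioo (0 : ℝ) 1) : edgeConst 1 s = s := by
  rw [edgeConst_eq one_pos (by norm_num) hs]
  norm_num [ProbabilityTheory.beta]

/-- The functional equation of Gamma, applied at `1 - κ` and at `1 - s (κ - 1)`; the second factor
cancels the prefactor. -/
lemma edgeConst_eq_of_lt_one {κ s : ℝ} (h0 : 0 < κ) (h1 : κ < 1) (hs : s ∈ Ioo (0 : ℝ) 1) :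
    edgeConst κ s =
      (1 - κ) / κ * (s * ProbabilityTheory.beta (s + κ * (1 - s)) (1 - κ)) := by
  rw [edgeConst_eq h0 (by linarith) hs]
  unfold ProbabilityTheory.beta
  have hp : 0 < 1 - s * (κ - 1) := by nlinarith [hs.1]
  have g1 := Real.Gamma_add_one (s := 1 - κ) (by linarith)
  have g2 := Real.Gamma_add_one (s := 1 - s * (κ - 1)) hp.ne'
  have g3 := Real.Gamma_pos_of_pos hp
  rw [show (2 - κ) = 1 - κ + 1 by ring, g1,
    show s + κ * (1 - s) + (1 - κ + 1) = 1 - s * (κ - 1) + 1 by ring, g2,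
    show s + κ * (1 - s) + (1 - κ) = 1 - s * (κ - 1) by ring]
  field_simp

/-! ### Endpoints with exponent above two -/

/-- For `u < 2 ε` the crude bound `2 C u^(κ-1)` is already at most `8 C ε^2 u^(κ-3)`, because `u^2 ≤
4 ε^2`. The condition `1 ≤ κ` makes `u^(κ-1)` monotone, which controls `h (u - ε)`. -/
lemma EdgeBound.gap_le {h : ℝ → ℝ} {κ R : ℝ} (hκ : 1 ≤ κ) (hb : EdgeBound h κ R) :
    ∃ C, 0 ≤ C ∧ ∀ s ∈ Icc (0 : ℝ) 1, ∀ ε u, 0 < ε → u ∈ Ioo 0 R →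
      amgmGap s (h u) (h (u - ε)) ≤ C * (ε ^ 2 * u ^ (κ - 3)) := by
  obtain ⟨C, hC, hC1, hC2⟩ := hb.bound
  refine ⟨8 * C, by positivity, fun s hs ε u hε hu => ?_⟩
  have hu0 := hu.1
  have hpow := Real.rpow_pos_of_pos hu0 (κ - 3)
  rcases le_or_gt (2 * ε) u with h2 | h2
  · refine (hC2 s hs ε u hε h2 hu.2).trans ?_
    have : 0 ≤ C * (ε ^ 2 * u ^ (κ - 3)) := by positivity
    nlinarith
  · have h3 : h (u - ε) ≤ C * u ^ (κ - 1) := by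
      rcases le_or_gt u ε with h1 | h1
      · rw [hb.zero _ (by linarith)]
        exact mul_nonneg hC (Real.rpow_nonneg hu0.le _)
      · refine (hC1 (u - ε) ⟨by linarith, by linarith [hu.2]⟩).trans ?_
        exact mul_le_mul_of_nonneg_left
          (Real.rpow_le_rpow (by linarith) (by linarith) (by linarith)) hC
    have e : u ^ (κ - 1) = u ^ 2 * u ^ (κ - 3) := by
      rw [← Real.rpow_natCast u 2, ← Real.rpow_add hu0]
      congr 1; push_cast; ring
    have h4 : u ^ 2 ≤ 4 * ε ^ 2 := by nlinarith
    calc amgmGap s (h u) (h (u - ε)) ≤ h u + h (u - ε) :=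
          amgmGap_le_add hs (hb.nonneg _) (hb.nonneg _)
      _ ≤ 2 * (C * u ^ (κ - 3)) * u ^ 2 := by
          have := hC1 u hu
          rw [e] at this h3
          linarith
      _ ≤ 2 * (C * u ^ (κ - 3)) * (4 * ε ^ 2) :=
          mul_le_mul_of_nonneg_left h4 (by positivity)
      _ = _ := by ring

lemma tendsto_gap_div_sq {h : ℝ → ℝ} {u s₀ : ℝ} (hd : DifferentiableAt ℝ h u) (hu : 0 < h u) :
    Tendsto (fun z : ℝ × ℝ => (z.1 ^ 2)⁻¹ * amgmGap z.2 (h u) (h (u - z.1)))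
      (𝓝[>] 0 ×ˢ 𝓝[Ioo 0 1] s₀) (𝓝 ((h u)⁻¹ * deriv h u ^ 2 * (s₀ * (1 - s₀) / 2))) := by
  have hε : Tendsto (fun z : ℝ × ℝ => u - z.1) (𝓝[>] 0 ×ˢ 𝓝[Ioo 0 1] s₀) (𝓝 u) := by
    simpa using tendsto_fst_nhds.const_sub u
  have hq := hd.continuousAt.tendsto.comp hε
  have hqpos : ∀ᶠ z : ℝ × ℝ in 𝓝[>] 0 ×ˢ 𝓝[Ioo 0 1] s₀, 0 < h (u - z.1) :=
    hq.eventually (lt_mem_nhds hu)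
  have hneg : Tendsto (fun z : ℝ × ℝ => -z.1) (𝓝[>] 0 ×ˢ 𝓝[Ioo 0 1] s₀) (𝓝[≠] 0) := by
    refine tendsto_nhdsWithin_iff.2 ⟨by simpa using tendsto_fst_nhds.neg, ?_⟩
    filter_upwards [eventually_fst_pos] with z hz
    simpa using hz.ne'
  have hslope := (hasDerivAt_iff_tendsto_slope_zero.1 (hd.hasDerivAt.log hu.ne')).comp hneg
  refine tendsto_amgmGap_of_log tendsto_snd_nhds (Eventually.of_forall fun _ => hu) hqpos ?_ ?_
  · have := ((Real.continuousAt_log hu.ne').tendsto.comp hq).const_sub (Real.log (h u))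
    simpa using this
  · have := hq.mul (hslope.pow 2)
    rw [show h u * (deriv h u / h u) ^ 2 = (h u)⁻¹ * deriv h u ^ 2 by field_simp] at this
    refine this.congr' ?_
    filter_upwards [eventually_fst_pos] with z hz
    simp only [Function.comp_apply, smul_eq_mul, ← sub_eq_add_neg]
    field_simp
    ring

/-- Leading order of the contribution of an endpoint with exponent above `2`. -/
lemma tendsto_edgeInt_of_two_lt {h : ℝ → ℝ} {κ L R : ℝ} (hκ : 2 < κ) (hL : 0 < L)
    (hR : L / 2 < R) (hb : EdgeBound h κ R) (hd : ∀ u ∈ Ioo 0 R, DifferentiableAt ℝ h u)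
    (hpos : ∀ u ∈ Ioo 0 R, 0 < h u) :
    IntegrableOn (fun u => (h u)⁻¹ * deriv h u ^ 2) (Ioo 0 (L / 2)) ∧
    ∀ s₀, Tendsto (fun z : ℝ × ℝ => edgeInt h L z.1 z.2 / z.1 ^ 2) (𝓝[>] 0 ×ˢ 𝓝[Ioo 0 1] s₀)
      (𝓝 (s₀ * (1 - s₀) / 2 * ∫ u in Ioo 0 (L / 2), (h u)⁻¹ * deriv h u ^ 2)) := by
  obtain ⟨C, hC, hgap⟩ := hb.gap_le (by linarith)
  have hbi : IntegrableOn (fun u : ℝ => C * u ^ (κ - 3)) (Ioo 0 R) := by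
    have := intervalIntegral.intervalIntegrable_rpow' (a := 0) (b := R) (r := κ - 3) (by linarith)
    rw [intervalIntegrable_iff_integrableOn_Ioo_of_le (by linarith)] at this
    exact this.const_mul C
  have hmaj : ∀ z : ℝ × ℝ, 0 < z.1 → z.2 ∈ Ioo (0 : ℝ) 1 → ∀ u ∈ Ioo 0 R,
      (z.1 ^ 2)⁻¹ * amgmGap z.2 (h u) (h (u - z.1)) ≤ C * u ^ (κ - 3) := by
    intro z hz hs u hu
    have := hgap z.2 (Ioo_subset_Icc_self hs) z.1 u hz hu
    rw [inv_mul_le_iff₀ (by positivity)]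
    linarith
  constructor
  -- The Fisher integrand inherits the majorant by letting `ε → 0` at `s = 1/2`, where `s (1 - s) /
  -- 2 = 1/8`; hence the factor `8`.
  · have hi := (hbi.mono_set (Ioo_subset_Ioo_right hR.le)).const_mul 8
    refine Integrable.mono' hi ?_ ?_
    · exact ((hb.measurable.inv).mul ((measurable_deriv h).pow_const 2)).aestronglyMeasurable
    · filter_upwards [ae_restrict_mem measurableSet_Ioo] with u hu
      have hu' : u ∈ Ioo 0 R := ⟨hu.1, hu.2.trans hR⟩
      have hu0 := hpos u hu'
      rw [Real.norm_of_nonneg (by positivity)]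
      have : (𝓝[Ioo (0 : ℝ) 1] (1 / 2)).NeBot :=
        mem_closure_iff_nhdsWithin_neBot.1 (subset_closure (by norm_num))
      have := le_of_tendsto (tendsto_gap_div_sq (s₀ := 1 / 2) (hd u hu') hu0)
        (b := C * u ^ (κ - 3)) (by
          filter_upwards [eventually_fst_pos, eventually_snd_mem] with z hz hs
          exact hmaj z hz hs u hu')
      linarith
  · intro s₀
    have key : Tendsto (fun z : ℝ × ℝ => ∫ u in Ioo 0 R, (Ioc 0 ((L + z.1) / 2)).indicator
        (fun u => (z.1 ^ 2)⁻¹ * amgmGap z.2 (h u) (h (u - z.1))) u)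
        (𝓝[>] 0 ×ˢ 𝓝[Ioo 0 1] s₀) (𝓝 (∫ u in Ioo 0 R, (Ioo 0 (L / 2)).indicator
          (fun u => (h u)⁻¹ * deriv h u ^ 2 * (s₀ * (1 - s₀) / 2)) u)) := by
      refine tendsto_integral_filter_of_dominated_convergence (fun u => C * u ^ (κ - 3))
        ?_ ?_ hbi ?_
      · refine Eventually.of_forall fun z => Measurable.aestronglyMeasurable ?_
        refine Measurable.indicator ?_ measurableSet_Ioc
        exact (measurable_amgmGap hb.measurable (hb.measurable.comp (by fun_prop))).const_mul _
      · filter_upwards [eventually_fst_pos, eventually_snd_mem] with z hz hs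
        filter_upwards [ae_restrict_mem measurableSet_Ioo] with u hu
        refine (norm_indicator_le_norm_self _ _).trans ?_
        rw [Real.norm_of_nonneg (mul_nonneg (by positivity)
          (amgmGap_nonneg (Ioo_subset_Icc_self hs) (hb.nonneg _) (hb.nonneg _)))]
        exact hmaj z hz hs u hu
      · filter_upwards [ae_restrict_of_ae (Measure.ae_ne volume (L / 2)),
          ae_restrict_mem measurableSet_Ioo] with u hne hu
        rcases lt_or_gt_of_ne hne with h1 | h1
        · rw [indicator_of_mem (show u ∈ Ioo 0 (L / 2) from ⟨hu.1, h1⟩)]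
          refine (tendsto_gap_div_sq (hd u hu) (hpos u hu)).congr' ?_
          filter_upwards [eventually_fst_pos] with z hz
          rw [indicator_of_mem]
          exact ⟨hu.1, by linarith⟩
        · rw [indicator_of_notMem (fun h => absurd h.2 (not_lt.2 h1.le))]
          refine tendsto_const_nhds.congr' ?_
          filter_upwards [eventually_fst_lt (show 0 < 2 * u - L by linarith)] with z hz
          rw [indicator_of_notMem]
          exact fun h => absurd h.2 (by linarith)
    rw [setIntegral_indicator measurableSet_Ioo,
      inter_eq_right.2 (Ioo_subset_Ioo_right hR.le), integral_mul_const, mul_comm] at key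
    refine key.congr' ?_
    filter_upwards [eventually_fst_lt (show 0 < 2 * R - L by linarith)] with z hz
    have hsub : Ioc 0 ((L + z.1) / 2) ⊆ Ioo 0 R := fun u hu => ⟨hu.1, by linarith [hu.2]⟩
    rw [setIntegral_indicator measurableSet_Ioc, inter_eq_right.2 hsub, integral_const_mul,
      inv_mul_eq_div]
    rfl

/-! ### Endpoints with exponent two -/

/-- If `h u ≈ A u` and `h' ≈ A` near `0`, the gap between `h u` and `h (u - ε)` with `ε ≪ u ≪ 1` is
to leading order `A s (1 - s) / 2 * ε ^ 2 / u`. -/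
lemma tendsto_gap_of_linear {ι : Type*} {l : Filter ι} {h : ℝ → ℝ} {A R s₀ : ℝ} {s ε u : ι → ℝ}
    (hA : 0 < A) (hR : 0 < R) (hd : ∀ u ∈ Ioo 0 R, DifferentiableAt ℝ h u)
    (hpos : ∀ u ∈ Ioo 0 R, 0 < h u)
    (hlim : Tendsto (fun u => h u / u) (𝓝[>] 0) (𝓝 A))
    (hlim' : Tendsto (deriv h) (𝓝[>] 0) (𝓝 A)) (hs : Tendsto s l (𝓝 s₀))
    (hu : Tendsto u l (𝓝[>] 0)) (hε : ∀ᶠ i in l, 0 < ε i)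
    (hεu : Tendsto (fun i => ε i / u i) l (𝓝 0)) :
    Tendsto (fun i => u i / ε i ^ 2 * amgmGap (s i) (h (u i)) (h (u i - ε i))) l
      (𝓝 (A * (s₀ * (1 - s₀) / 2))) := by
  have hu0 : ∀ᶠ i in l, 0 < u i := hu.eventually self_mem_nhdsWithin
  have huR : ∀ᶠ i in l, u i < R :=
    (hu.mono_right nhdsWithin_le_nhds).eventually (gt_mem_nhds hR)
  have hεlt : ∀ᶠ i in l, ε i < u i := by
    filter_upwards [hεu.eventually (gt_mem_nhds one_pos), hu0] with i hi h0
    rwa [div_lt_one h0] at hi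
  -- The mean value theorem for `log h`. As `ε / u → 0`, the intermediate point is asymptotic to
  -- `u`, and `h' / h` there to `1 / u`.
  have hmvt : ∀ᶠ i in l, ∃ ξ, u i - ε i < ξ ∧ ξ < u i ∧
      Real.log (h (u i)) - Real.log (h (u i - ε i)) = ε i * (deriv h ξ / h ξ) := by
    filter_upwards [hε, huR, hεlt] with i hε hR hlt
    have hmem : ∀ x ∈ Icc (u i - ε i) (u i), x ∈ Ioo 0 R := fun x hx =>
      ⟨by linarith [hx.1], by linarith [hx.2]⟩
    have hdl : ∀ x ∈ Icc (u i - ε i) (u i),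
        HasDerivAt (fun x => Real.log (h x)) (deriv h x / h x) x := fun x hx =>
      (hd x (hmem x hx)).hasDerivAt.log (hpos x (hmem x hx)).ne'
    obtain ⟨ξ, hξ, e⟩ := exists_hasDerivAt_eq_slope (fun x => Real.log (h x))
      (fun x => deriv h x / h x) (show u i - ε i < u i by linarith)
      (fun x hx => (hdl x hx).continuousAt.continuousWithinAt)
      (fun x hx => hdl x (Ioo_subset_Icc_self hx))
    refine ⟨ξ, hξ.1, hξ.2, ?_⟩
    rw [e, sub_sub_cancel, mul_div_cancel₀ _ hε.ne']
  obtain ⟨ξ, hξ⟩ := skolem.1 hmvt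
  have hone : Tendsto (fun i => 1 - ε i / u i) l (𝓝 1) := by simpa using hεu.const_sub 1
  have hratio : Tendsto (fun i => ξ i / u i) l (𝓝 1) := by
    refine tendsto_of_tendsto_of_tendsto_of_le_of_le' hone tendsto_const_nhds ?_ ?_
    · filter_upwards [hξ, hu0] with i hi h0
      rw [le_div_iff₀ h0, sub_mul, div_mul_cancel₀ _ h0.ne']; linarith [hi.1]
    · filter_upwards [hξ, hu0] with i hi h0
      exact (div_le_one h0).2 hi.2.1.le
  have hξ0 : ∀ᶠ i in l, 0 < ξ i := by
    filter_upwards [hξ, hεlt] with i hi h0 using by linarith [hi.1]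
  have hu' := hu.mono_right nhdsWithin_le_nhds
  have hξlim : Tendsto ξ l (𝓝[>] 0) := by
    refine tendsto_nhdsWithin_iff.2 ⟨?_, hξ0⟩
    refine squeeze_zero' (hξ0.mono fun _ h => h.le) ?_ hu'
    filter_upwards [hξ] with i hi using hi.2.1.le
  have hwlim : Tendsto (fun i => u i - ε i) l (𝓝[>] 0) := by
    refine tendsto_nhdsWithin_iff.2 ⟨?_, by filter_upwards [hεlt] with i hi using sub_pos.2 hi⟩
    refine squeeze_zero' (by filter_upwards [hεlt] with i hi using (sub_pos.2 hi).le) ?_ hu'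
    filter_upwards [hε] with i hi using by linarith
  have t1 := hlim.comp hξlim
  have t2 := hlim'.comp hξlim
  have t3 := hlim.comp hwlim
  have hinv := (hratio.inv₀ one_ne_zero)
  have tq := (t2.div t1 hA.ne').mul hinv
  refine tendsto_amgmGap_of_log hs ?_ ?_ ?_ ?_
  · filter_upwards [hu0, huR] with i h0 h1 using hpos _ ⟨h0, h1⟩
  · filter_upwards [hεlt, huR, hε] with i h0 h1 h2 using hpos _ ⟨by linarith, by linarith⟩
  · have := hεu.mul tq
    rw [zero_mul] at this
    refine this.congr' ?_
    filter_upwards [hξ, hu0, hξ0] with i hi h0 h1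
    rw [hi.2.2]
    simp only [Function.comp_apply, Pi.div_apply]
    field_simp
  · have := (t3.mul hone).mul (tq.pow 2)
    rw [show A * 1 * (A / A * 1⁻¹) ^ 2 = A by field_simp] at this
    refine this.congr' ?_
    filter_upwards [hξ, hu0, hξ0, hεlt, hε] with i hi h0 h1 h2 h3
    rw [hi.2.2]
    simp only [Function.comp_apply, Pi.div_apply]
    have h4 : u i - ε i ≠ 0 := (sub_pos.2 h2).ne'
    field_simp

/-- The substitution `u = ε^τ`: its Jacobian supplies the factor `-log ε`, and the scales between
`ε` and `1` become `0 < τ < 1`. -/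
lemma integral_Ioi_eq_integral_const_rpow {ε : ℝ} (hε : 0 < ε) (hε1 : ε < 1) (g : ℝ → ℝ) :
    ∫ u in Ioi 0, g u = ∫ τ : ℝ, ε ^ τ * -Real.log ε * g (ε ^ τ) := by
  have hlog := Real.log_neg hε hε1
  have himg : (fun τ : ℝ => ε ^ τ) '' univ = Ioi 0 := by
    ext u
    simp only [image_univ, mem_range, mem_Ioi]
    exact ⟨fun ⟨τ, hτ⟩ => hτ ▸ Real.rpow_pos_of_pos hε τ,
      fun hu => ⟨Real.logb ε u, Real.rpow_logb hε hε1.ne hu⟩⟩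
  rw [← himg, integral_image_eq_integral_abs_deriv_smul MeasurableSet.univ
    (fun τ _ => (Real.hasStrictDerivAt_const_rpow hε τ).hasDerivAt.hasDerivWithinAt)
    ((Real.strictAnti_rpow_of_base_lt_one hε hε1).injective.injOn)]
  rw [setIntegral_univ]
  congr 1 with τ
  rw [abs_mul, abs_of_pos (Real.rpow_pos_of_pos hε τ), abs_of_neg hlog, smul_eq_mul]

lemma edgeInt_div_sq_log_eq {h : ℝ → ℝ} {L ε s : ℝ} (hε : 0 < ε) (hε1 : ε < 1) :
    edgeInt h L ε s / (-ε ^ 2 * Real.log ε) = ∫ τ : ℝ, (Iic ((L + ε) / 2)).indicator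
      (fun u => u / ε ^ 2 * amgmGap s (h u) (h (u - ε))) (ε ^ τ) := by
  have hlog := Real.log_neg hε hε1
  have e : edgeInt h L ε s = ∫ u in Ioi 0, (Iic ((L + ε) / 2)).indicator
      (fun u => amgmGap s (h u) (h (u - ε))) u := by
    rw [setIntegral_indicator measurableSet_Iic, Ioi_inter_Iic]; rfl
  rw [e, integral_Ioi_eq_integral_const_rpow hε hε1, div_eq_inv_mul, ← integral_const_mul]
  congr 1 with τ
  by_cases hm : ε ^ τ ∈ Iic ((L + ε) / 2)
  · rw [indicator_of_mem hm, indicator_of_mem hm]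
    have := hlog.ne
    field_simp
  · rw [indicator_of_notMem hm, indicator_of_notMem hm]; simp

/-- Leading order of the contribution of an endpoint with exponent `2`. -/
lemma tendsto_edgeInt_of_eq_two {h : ℝ → ℝ} {A L R s₀ : ℝ} (hL : 0 < L)
    (hR : L / 2 < R) (hb : EdgeBound h 2 R) (hA : 0 < A)
    (hd : ∀ u ∈ Ioo 0 R, DifferentiableAt ℝ h u) (hpos : ∀ u ∈ Ioo 0 R, 0 < h u)
    (hlim : Tendsto (fun u => h u / u) (𝓝[>] 0) (𝓝 A))
    (hlim' : Tendsto (deriv h) (𝓝[>] 0) (𝓝 A)) :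
    Tendsto (fun z : ℝ × ℝ => edgeInt h L z.1 z.2 / (-z.1 ^ 2 * Real.log z.1))
      (𝓝[>] 0 ×ˢ 𝓝[Ioo 0 1] s₀) (𝓝 (A * (s₀ * (1 - s₀) / 2))) := by
  have hR0 : 0 < R := by linarith
  obtain ⟨C₁, hC₁, hgap⟩ := hb.gap_le one_le_two
  obtain ⟨C₂, hC₂, hgrow, -⟩ := hb.bound
  -- the integrand is bounded on `(0, R)`, and decays for `u < ε`
  have hmaj1 : ∀ s ∈ Icc (0 : ℝ) 1, ∀ ε u, 0 < ε → u ∈ Ioo 0 R →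
      u / ε ^ 2 * amgmGap s (h u) (h (u - ε)) ≤ C₁ := by
    intro s hs ε u hε hu
    have hu0 := hu.1
    have := mul_le_mul_of_nonneg_left (hgap s hs ε u hε hu) (show 0 ≤ u / ε ^ 2 by positivity)
    rw [show (2 : ℝ) - 3 = -1 by norm_num, Real.rpow_neg_one] at this
    refine this.trans_eq ?_
    field_simp
  have hmaj2 : ∀ s ∈ Icc (0 : ℝ) 1, ∀ ε u, 0 < ε → u ∈ Ioo 0 R → u ≤ ε →
      u / ε ^ 2 * amgmGap s (h u) (h (u - ε)) ≤ C₂ * (u / ε) ^ 2 := by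
    intro s hs ε u hε hu huε
    have hu0 := hu.1
    have h1 := amgmGap_le_add hs (hb.nonneg u) (hb.nonneg (u - ε))
    have h2 := hgrow u hu
    rw [show (2 : ℝ) - 1 = 1 by norm_num, Real.rpow_one] at h2
    rw [hb.zero (u - ε) (by linarith)] at h1 ⊢
    have := mul_le_mul_of_nonneg_left (h1.trans (by linarith : h u + 0 ≤ C₂ * u))
      (show 0 ≤ u / ε ^ 2 by positivity)
    refine this.trans_eq ?_
    field_simp
  -- For `τ > 1`, that is `u < ε`, the bound `(u / ε)^2 = ε^(2(τ-1))` is at most `e^(2-2τ)` once `ε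
  -- < e^(-1)`.
  set bd : ℝ → ℝ := fun τ => (Icc (-1 : ℝ) 1).indicator (fun _ => C₁) τ +
    (Ioi 1).indicator (fun τ => C₂ * (Real.exp 2 * Real.exp (-2 * τ))) τ with hbd
  have hbi : Integrable bd := by
    refine (integrable_indicator_iff measurableSet_Icc |>.2 (by simp)).add
      (integrable_indicator_iff measurableSet_Ioi |>.2 ?_)
    exact ((integrableOn_exp_mul_Ioi (by norm_num) 1).const_mul _).const_mul _
  have hbd0 : ∀ τ, 0 ≤ bd τ := fun τ => add_nonneg (indicator_nonneg (fun _ _ => hC₁) _)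
    (indicator_nonneg (fun _ _ => by positivity) _)
  have key : Tendsto (fun z : ℝ × ℝ => ∫ τ : ℝ, (Iic ((L + z.1) / 2)).indicator
      (fun u => u / z.1 ^ 2 * amgmGap z.2 (h u) (h (u - z.1))) (z.1 ^ τ))
      (𝓝[>] 0 ×ˢ 𝓝[Ioo 0 1] s₀) (𝓝 (∫ τ : ℝ, (Ioo (0 : ℝ) 1).indicator
        (fun _ => A * (s₀ * (1 - s₀) / 2)) τ)) := by
    refine tendsto_integral_filter_of_dominated_convergence bd ?_ ?_ hbi ?_
    · refine Eventually.of_forall fun z => Measurable.aestronglyMeasurable ?_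
      have hm : Measurable ((Iic ((L + z.1) / 2)).indicator
          (fun u => u / z.1 ^ 2 * amgmGap z.2 (h u) (h (u - z.1)))) :=
        ((measurable_id.div_const _).mul (measurable_amgmGap hb.measurable
          (hb.measurable.comp (by fun_prop)))).indicator measurableSet_Iic
      exact hm.comp (by fun_prop)
    · filter_upwards [eventually_fst_pos, eventually_snd_mem,
        eventually_fst_lt (show 0 < 2 * R - L by linarith),
        eventually_fst_lt (show 0 < R⁻¹ by positivity),
        eventually_fst_lt (Real.exp_pos (-1))] with z hz hs hzR hzR' hze
      have hs' := Ioo_subset_Icc_self hs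
      have hz1 : z.1 < 1 := hze.trans (by simp)
      refine Eventually.of_forall fun τ => ?_
      by_cases hm : z.1 ^ τ ∈ Iic ((L + z.1) / 2)
      · have hu : z.1 ^ τ ∈ Ioo 0 R :=
          ⟨Real.rpow_pos_of_pos hz _, lt_of_le_of_lt hm (by linarith)⟩
        rw [indicator_of_mem hm, Real.norm_of_nonneg (mul_nonneg (by positivity)
          (amgmGap_nonneg hs' (hb.nonneg _) (hb.nonneg _)))]
        -- If `τ < -1`, then `ε^τ > 1 / ε > R`, contradicting `u < R`.
        have hτ : -1 ≤ τ := by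
          by_contra! hlt
          have h1 := Real.rpow_lt_rpow_of_exponent_gt hz hz1 hlt
          rw [Real.rpow_neg_one] at h1
          have h2 : R < z.1⁻¹ := by rwa [lt_inv_comm₀ hR0 hz]
          linarith [hu.2]
        simp only [hbd]
        rcases le_or_gt τ 1 with h1 | h1
        · rw [indicator_of_mem (show τ ∈ Icc (-1 : ℝ) 1 from ⟨hτ, h1⟩),
            indicator_of_notMem (by simpa using h1), add_zero]
          exact hmaj1 z.2 hs' z.1 _ hz hu
        · rw [indicator_of_notMem (show τ ∉ Icc (-1 : ℝ) 1 from fun h => absurd h.2 (not_le.2 h1)),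
            indicator_of_mem (show τ ∈ Ioi 1 from h1), zero_add]
          have hle : z.1 ^ τ ≤ z.1 := by
            simpa using Real.rpow_le_rpow_of_exponent_ge hz hz1.le h1.le
          refine (hmaj2 z.2 hs' z.1 _ hz hu hle).trans (mul_le_mul_of_nonneg_left ?_ hC₂)
          rw [← Real.exp_add, ← Real.rpow_sub_one hz.ne']
          have h3 : z.1 ^ (τ - 1) ≤ Real.exp (-1) ^ (τ - 1) :=
            Real.rpow_le_rpow hz.le hze.le (by linarith)
          refine (pow_le_pow_left₀ (by positivity) h3 2).trans_eq ?_
          rw [← Real.exp_mul, ← Real.exp_nat_mul]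
          congr 1; push_cast; ring
      · rw [indicator_of_notMem hm, norm_zero]
        exact hbd0 τ
    -- Three regimes: for `τ < 0`, `ε^τ` leaves the domain; for `0 < τ < 1`, `ε ≪ u ≪ 1` and the
    -- linear expansion applies; for `τ > 1`, `(u / ε)^2 → 0`.
    · filter_upwards [Measure.ae_ne volume 0, Measure.ae_ne volume 1] with τ h0 h1
      have hposu : ∀ᶠ z : ℝ × ℝ in 𝓝[>] 0 ×ˢ 𝓝[Ioo 0 1] s₀, 0 < z.1 ^ τ := by
        filter_upwards [eventually_fst_pos] with z hz using Real.rpow_pos_of_pos hz _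
      have hrp : ∀ p : ℝ, 0 < p → Tendsto (fun z : ℝ × ℝ => z.1 ^ p)
          (𝓝[>] 0 ×ˢ 𝓝[Ioo 0 1] s₀) (𝓝 0) := by
        intro p hp
        have := tendsto_fst_nhds (s₀ := s₀).rpow_const (p := p) (Or.inr hp.le)
        rwa [Real.zero_rpow hp.ne'] at this
      rcases lt_or_gt_of_ne h0 with h0 | h0
      · rw [indicator_of_notMem (fun h => absurd h.1 (not_lt.2 h0.le))]
        refine tendsto_const_nhds.congr' ?_
        have := hrp (-τ) (by linarith)
        filter_upwards [eventually_fst_pos, eventually_fst_lt hL,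
          this.eventually (gt_mem_nhds (inv_pos.2 hL))] with z hz hzL hlt
        rw [indicator_of_notMem]
        rw [Real.rpow_neg hz.le, inv_lt_inv₀ (Real.rpow_pos_of_pos hz _) hL] at hlt
        exact fun h => absurd (mem_Iic.1 h) (by linarith)
      · have hin : ∀ᶠ z : ℝ × ℝ in 𝓝[>] 0 ×ˢ 𝓝[Ioo 0 1] s₀, z.1 ^ τ < L / 2 :=
          (hrp τ h0).eventually (gt_mem_nhds (by positivity))
        rcases lt_or_gt_of_ne h1 with h1 | h1
        · rw [indicator_of_mem (show τ ∈ Ioo (0 : ℝ) 1 from ⟨h0, h1⟩)]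
          have := tendsto_gap_of_linear hA hR0 hd hpos hlim hlim' (tendsto_snd_nhds (s₀ := s₀))
            (tendsto_nhdsWithin_iff.2 ⟨hrp τ h0, hposu⟩) eventually_fst_pos
            ((hrp (1 - τ) (by linarith)).congr' (by
              filter_upwards [eventually_fst_pos] with z hz
              rw [Real.rpow_sub hz, Real.rpow_one]))
          refine this.congr' ?_
          filter_upwards [hin, eventually_fst_pos] with z hz hz0
          rw [indicator_of_mem]
          exact mem_Iic.2 (by linarith)
        · rw [indicator_of_notMem (fun h => absurd h.2 (not_lt.2 h1.le))]
          have hsq := ((hrp (τ - 1) (by linarith)).pow 2).const_mul C₂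
          rw [zero_pow two_ne_zero, mul_zero] at hsq
          refine squeeze_zero' ?_ ?_ hsq
          · filter_upwards [eventually_snd_mem, hposu] with z hs hz
            refine indicator_apply_nonneg fun _ => mul_nonneg (by positivity)
              (amgmGap_nonneg (Ioo_subset_Icc_self hs) (hb.nonneg _) (hb.nonneg _))
          · filter_upwards [eventually_snd_mem, hposu, hin, eventually_fst_pos,
              eventually_fst_lt one_pos] with z hs hz hzL hz0 hz1
            rw [indicator_of_mem (mem_Iic.2 (by linarith)), Real.rpow_sub_one hz0.ne']
            refine hmaj2 z.2 (Ioo_subset_Icc_self hs) z.1 _ hz0 ⟨hz, by linarith⟩ ?_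
            simpa using Real.rpow_le_rpow_of_exponent_ge hz0 hz1.le h1.le
  rw [integral_indicator measurableSet_Ioo, setIntegral_const] at key
  simp only [Real.volume_real_Ioo_of_le zero_le_one, sub_zero, one_smul] at key
  refine key.congr' ?_
  filter_upwards [eventually_fst_pos, eventually_fst_lt one_pos] with z hz hz1
  rw [edgeInt_div_sq_log_eq hz hz1]

/-! ### Uniformity in the parameter and removal of the logarithm -/

/-- Joint convergence at every point of the compact interval `[0, 1]` gives uniform convergence. -/
lemma tendstoUniformlyOn_of_tendsto_prod {F : ℝ → ℝ → ℝ} {G c : ℝ → ℝ} {l : Filter ℝ} [l.NeBot]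
    (h : ∀ s₀ ∈ Icc (0 : ℝ) 1,
      Tendsto (fun z : ℝ × ℝ => F z.1 z.2) (l ×ˢ 𝓝[Ioo 0 1] s₀) (𝓝 (c s₀)))
    (hc : ∀ s ∈ Ioo (0 : ℝ) 1, c s = G s) : TendstoUniformlyOn F G l (Ioo 0 1) := by
  have hpt : ∀ s ∈ Ioo (0 : ℝ) 1, Tendsto (fun ε => F ε s) l (𝓝 (G s)) := by
    intro s hs
    rw [← hc s hs]
    exact (h s (Ioo_subset_Icc_self hs)).comp
      (tendsto_id.prodMk (tendsto_const_nhdsWithin hs))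
  rw [Metric.tendstoUniformlyOn_iff]
  intro η hη
  suffices H : ∀ᶠ ε in l, ∀ s ∈ Icc (0 : ℝ) 1 ∩ Ioo 0 1, dist (G s) (F ε s) < η by
    filter_upwards [H] with ε hε s hs using hε s ⟨Ioo_subset_Icc_self hs, hs⟩
  refine isCompact_Icc.induction_on (p := fun S => ∀ᶠ ε in l, ∀ s ∈ S ∩ Ioo (0 : ℝ) 1,
    dist (G s) (F ε s) < η) (by simp) ?_ ?_ ?_
  · intro S T hST hT
    filter_upwards [hT] with ε hε s hs using hε s ⟨hST hs.1, hs.2⟩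
  · intro S T hS hT
    filter_upwards [hS, hT] with ε h1 h2 s hs
    rcases hs.1 with hs1 | hs1
    · exact h1 s ⟨hs1, hs.2⟩
    · exact h2 s ⟨hs1, hs.2⟩
  · intro s₀ hs₀
    have h1 := (h s₀ hs₀).eventually (Metric.ball_mem_nhds (c s₀) (show 0 < η / 3 by positivity))
    obtain ⟨p, hp, q, hq, hpq⟩ := eventually_prod_iff.1 h1
    obtain ⟨V, hV, hVq⟩ := mem_nhdsWithin_iff_exists_mem_nhds_inter.1 hq
    refine ⟨V, mem_nhdsWithin_of_mem_nhds hV, ?_⟩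
    filter_upwards [hp] with ε hε s hs
    have hqs : q s := hVq hs
    -- No continuity of `c` is assumed: letting the first variable tend to its limit at fixed `s` in
    -- the same estimate bounds `G s - c s₀`.
    have h2 : dist (G s) (c s₀) ≤ η / 3 := by
      refine le_of_tendsto ((hpt s hs.2).dist tendsto_const_nhds) ?_
      filter_upwards [hp] with δ hδ using (Metric.mem_ball.1 (hpq hδ hqs)).le
    have h3 : dist (F ε s) (c s₀) < η / 3 := hpq hε hqs
    have := dist_triangle_right (G s) (F ε s) (c s₀)
    linarith

/-- Convergence of `D / w` with `w → 0` forces `D → 0`; `dslope` then gives the quotient `-log (1 -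
D) / D` a continuous value even where `D = 0`. -/
lemma tendsto_neg_log_one_sub_div {ι : Type*} {l : Filter ι} {D w : ι → ℝ} {c : ℝ}
    (hw : Tendsto w l (𝓝 0)) (hw0 : ∀ᶠ i in l, w i ≠ 0)
    (hD : Tendsto (fun i => D i / w i) l (𝓝 c)) :
    Tendsto (fun i => -Real.log (1 - D i) / w i) l (𝓝 c) := by
  have hD0 : Tendsto D l (𝓝 0) := by
    have := hD.mul hw
    rw [mul_zero] at this
    refine this.congr' ?_
    filter_upwards [hw0] with i hi using div_mul_cancel₀ _ hi
  have hder : HasDerivAt (fun t : ℝ => -Real.log (1 - t)) 1 0 := by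
    have := (((hasDerivAt_id (0 : ℝ)).const_sub 1).log (by simp)).neg
    rw [neg_div, neg_neg, id, sub_zero, div_one] at this
    exact this
  have hds : Tendsto (dslope (fun t : ℝ => -Real.log (1 - t)) 0) (𝓝 0) (𝓝 1) := by
    have h1 : ContinuousAt (dslope (fun t : ℝ => -Real.log (1 - t)) 0) 0 :=
      continuousAt_dslope_same.2 hder.differentiableAt
    have h2 := h1.tendsto
    rwa [dslope_same, hder.deriv] at h2
  have := hD.mul (hds.comp hD0)
  rw [mul_one] at this
  refine this.congr fun i => ?_
  have e := sub_smul_dslope (fun t : ℝ => -Real.log (1 - t)) 0 (D i)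
  simp only [sub_zero, smul_eq_mul, Real.log_one, neg_zero] at e
  rw [← e]
  simp only [Function.comp_apply]
  ring

/-! ### From endpoint behaviour to profile bounds -/

lemma exists_le_of_continuousOn_Ioc {g : ℝ → ℝ} {R C₀ : ℝ} (hg : ContinuousOn g (Ioc 0 R))
    (h0 : ∀ᶠ u in 𝓝[>] 0, g u ≤ C₀) : ∃ C, 0 < C ∧ ∀ u ∈ Ioc 0 R, g u ≤ C := by
  obtain ⟨δ, hδ, hδC⟩ := mem_nhdsGT_iff_exists_Ioo_subset.1 h0
  obtain ⟨M, hM⟩ := (isCompact_Icc (a := δ) (b := R)).bddAbove_image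
    (hg.mono fun u hu => ⟨lt_of_lt_of_le hδ hu.1, hu.2⟩)
  refine ⟨max 1 (max C₀ M), by positivity, fun u hu => ?_⟩
  rcases lt_or_ge u δ with h | h
  · exact (hδC ⟨hu.1, h⟩).trans ((le_max_left _ _).trans (le_max_right _ _))
  · exact (hM ⟨u, ⟨h, hu.2⟩, rfl⟩).trans ((le_max_right _ _).trans (le_max_right _ _))

lemma tendsto_div_rpow_of_isEquivalent {g : ℝ → ℝ} {B p : ℝ}
    (h : g ~[𝓝[>] 0] fun u => B * u ^ p) : Tendsto (fun u => g u / u ^ p) (𝓝[>] 0) (𝓝 B) := by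
  have h1 := h.div (IsEquivalent.refl (u := fun u : ℝ => u ^ p) (l := 𝓝[>] 0))
  refine IsEquivalent.tendsto_const (h1.trans_eventuallyEq ?_)
  filter_upwards [self_mem_nhdsWithin] with u hu
  exact mul_div_cancel_right₀ _ (Real.rpow_pos_of_pos hu _).ne'

/-- A one-sided density profile: it vanishes on `(-∞, 0]`, is positive and smooth on `(0, L)` and has
the prescribed behaviour at `0`. -/
structure EdgeProfile (h : ℝ → ℝ) (κ A L : ℝ) : Prop where
  measurable : Measurable h
  nonneg : ∀ u, 0 ≤ h u
  zero : ∀ u ≤ 0, h u = 0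
  pos : ∀ u ∈ Ioo 0 L, 0 < h u
  contDiffOn : ContDiffOn ℝ 3 h (Ioo 0 L)
  behavior : EndpointBehavior h κ A

namespace EdgeProfile

variable {h : ℝ → ℝ} {κ A L : ℝ}

lemma differentiableAt (hp : EdgeProfile h κ A L) {u : ℝ} (hu : u ∈ Ioo 0 L) :
    DifferentiableAt ℝ h u :=
  (hp.contDiffOn.contDiffAt (Ioo_mem_nhds hu.1 hu.2)).differentiableAt (by norm_num)

/-- The ratio limit gives `A ≥ 0`. Equivalence to zero would force `h` to vanish near `0`, against
positivity on `(0, L)`. -/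
lemma coeff_pos (hp : EdgeProfile h κ A L) (hL : 0 < L) : 0 < A := by
  have hev : ∀ᶠ u in 𝓝[>] (0 : ℝ), u ∈ Ioo 0 L := Ioo_mem_nhdsGT hL
  refine lt_of_le_of_ne (ge_of_tendsto
    (tendsto_div_rpow_of_isEquivalent hp.behavior.equiv_zero) ?_) ?_
  · filter_upwards [hev] with u hu
    exact div_nonneg (hp.nonneg u) (Real.rpow_nonneg hu.1.le _)
  · rintro rfl
    have h0 := hp.behavior.equiv_zero
    simp only [zero_mul] at h0
    have h1 := isEquivalent_zero_iff_eventually_zero.1 h0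
    obtain ⟨u, hu, hu'⟩ := (h1.and hev).exists
    exact (hp.pos u hu').ne' hu

/-- Only boundedness of the ratio is needed later. At `κ = 1` the derivative has a finite limit, so
the ratio `u h' u` tends to `0`. -/
lemma exists_tendsto_deriv (hp : EdgeProfile h κ A L) :
    ∃ B, Tendsto (fun u => deriv h u / u ^ (κ - 2)) (𝓝[>] 0) (𝓝 B) := by
  by_cases hκ : κ = 1
  · obtain ⟨⟨l, hl⟩, -⟩ := hp.behavior.limits_one hκ
    have hid : Tendsto (fun u : ℝ => u) (𝓝[>] 0) (𝓝 0) := tendsto_id.mono_right nhdsWithin_le_nhds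
    refine ⟨l * 0, (hl.mul hid).congr fun u => ?_⟩
    rw [hκ, show (1 : ℝ) - 2 = -1 by norm_num, Real.rpow_neg_one, div_inv_eq_mul]
  · exact ⟨_, tendsto_div_rpow_of_isEquivalent (hp.behavior.equiv_one hκ)⟩

lemma edgeBound (hp : EdgeProfile h κ A L) {R : ℝ} (hR : 0 < R) (hRL : R < L) :
    EdgeBound h κ R := by
  have hA := hp.coeff_pos (hR.trans hRL)
  have hlim := tendsto_div_rpow_of_isEquivalent hp.behavior.equiv_zero
  have hsub : Ioc 0 R ⊆ Ioo 0 L := fun u hu => ⟨hu.1, hu.2.trans_lt hRL⟩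
  have hch : ContinuousOn h (Ioc 0 R) := (hp.contDiffOn.continuousOn).mono hsub
  have hcd : ContinuousOn (deriv h) (Ioc 0 R) :=
    (hp.contDiffOn.continuousOn_deriv_of_isOpen isOpen_Ioo (by norm_num)).mono hsub
  have hcp : ∀ p : ℝ, ContinuousOn (fun u : ℝ => u ^ p) (Ioc 0 R) := fun p =>
    continuousOn_id.rpow_const fun u hu => Or.inl hu.1.ne'
  have hp0 : ∀ p : ℝ, ∀ u ∈ Ioc 0 R, u ^ p ≠ 0 := fun p u hu => (Real.rpow_pos_of_pos hu.1 p).ne'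
  obtain ⟨C₁, hC₁, h1⟩ := exists_le_of_continuousOn_Ioc (hch.div (hcp (κ - 1)) (hp0 _))
    (hlim.eventually (ge_mem_nhds (lt_add_one A)))
  -- The lower bound on `h` is obtained as an upper bound on the reciprocal ratio, whose limit `A⁻¹`
  -- is finite.
  obtain ⟨C₂, hC₂, h2⟩ := exists_le_of_continuousOn_Ioc
    ((hcp (κ - 1)).div hch fun u hu => (hp.pos u (hsub hu)).ne')
    (((hlim.inv₀ hA.ne').congr fun u => inv_div _ _).eventually (ge_mem_nhds (lt_add_one A⁻¹)))
  obtain ⟨B, hB⟩ := hp.exists_tendsto_deriv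
  obtain ⟨C₃, hC₃, h3⟩ := exists_le_of_continuousOn_Ioc (hcd.div (hcp (κ - 2)) (hp0 _)).abs
    (hB.abs.eventually (ge_mem_nhds (lt_add_one |B|)))
  refine EdgeBound.of_deriv_bounds (c := C₂⁻¹) (C := C₃) (C' := C₁) hp.measurable hp.nonneg hp.zero
    (inv_pos.2 hC₂) hC₁.le
    (fun u hu => hp.differentiableAt ⟨hu.1, hu.2.trans hRL⟩) (fun u hu => ?_) (fun u hu => ?_)
    (fun u hu => ?_)
  · have := h2 u (Ioo_subset_Ioc_self hu)
    rw [Pi.div_apply, div_le_iff₀ (hp.pos u ⟨hu.1, hu.2.trans hRL⟩)] at this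
    rwa [inv_mul_le_iff₀ hC₂]
  · have := h1 u (Ioo_subset_Ioc_self hu)
    rwa [Pi.div_apply, div_le_iff₀ (Real.rpow_pos_of_pos hu.1 _)] at this
  · have := h3 u (Ioo_subset_Ioc_self hu)
    rwa [Pi.div_apply, abs_div, abs_of_pos (Real.rpow_pos_of_pos hu.1 (κ - 2)),
      div_le_iff₀ (Real.rpow_pos_of_pos hu.1 _)] at this

end EdgeProfile

/-- On `(0, R)` a power with larger exponent costs only the factor `R^(κ' - κ)`, so the milder
endpoint can be measured at the rate of the sharper one. -/
lemma EdgeBound.mono {h : ℝ → ℝ} {κ κ' R : ℝ} (hκ : κ ≤ κ') (hR : 0 < R) (hb : EdgeBound h κ' R) :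
    EdgeBound h κ R := by
  obtain ⟨C, hC, h1, h2⟩ := hb.bound
  have hpow : ∀ u ∈ Ioo 0 R, ∀ c, u ^ (κ' - c) ≤ R ^ (κ' - κ) * u ^ (κ - c) := by
    intro u hu c
    rw [show κ' - c = (κ' - κ) + (κ - c) by ring, Real.rpow_add hu.1]
    exact mul_le_mul_of_nonneg_right (Real.rpow_le_rpow hu.1.le hu.2.le (by linarith))
      (Real.rpow_nonneg hu.1.le _)
  refine ⟨hb.measurable, hb.nonneg, hb.zero, C * R ^ (κ' - κ), by positivity,
    fun u hu => (h1 u hu).trans ?_, fun s hs ε u hε hεu huR => (h2 s hs ε u hε hεu huR).trans ?_⟩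
  · rw [mul_assoc]
    exact mul_le_mul_of_nonneg_left (hpow u hu 1) hC
  · have := mul_le_mul_of_nonneg_left (hpow u ⟨by linarith, huR⟩ 3)
      (show 0 ≤ C * ε ^ 2 by positivity)
    linarith

lemma tendsto_div_rpow_of_lt {h : ℝ → ℝ} {κ κ' A : ℝ} (hκ : κ < κ')
    (hlim : Tendsto (fun u => h u / u ^ (κ' - 1)) (𝓝[>] 0) (𝓝 A)) :
    Tendsto (fun u => h u / u ^ (κ - 1)) (𝓝[>] 0) (𝓝 0) := by
  have hpow : Tendsto (fun u : ℝ => u ^ (κ' - κ)) (𝓝[>] 0) (𝓝 0) := by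
    have := (Real.continuousAt_rpow_const 0 (κ' - κ) (Or.inr (by linarith))).tendsto
    rw [Real.zero_rpow (by linarith)] at this
    exact this.mono_left nhdsWithin_le_nhds
  have := hlim.mul hpow
  rw [mul_zero] at this
  refine this.congr' ?_
  filter_upwards [self_mem_nhdsWithin] with u hu
  have hu0 : 0 < u := hu
  have e : u ^ (κ' - 1) = u ^ (κ' - κ) * u ^ (κ - 1) := by rw [← Real.rpow_add hu0]; ring_nf
  have h1 := Real.rpow_pos_of_pos hu0 (κ' - κ)
  have h2 := Real.rpow_pos_of_pos hu0 (κ - 1)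
  rw [e]
  field_simp

/-! ### Reduction of the entropy to the two endpoints -/

namespace IsC3DensityOn

variable {f : ℝ → ℝ} {a b : ℝ}

lemma lt (hf : IsC3DensityOn f a b) : a < b := by
  by_contra hab
  have h0 : f = 0 := by
    rw [← Function.support_eq_empty_iff, hf.support_eq, Ioo_eq_empty hab]
  have := hf.integral_eq_one
  rw [h0] at this
  simp at this

lemma pos (hf : IsC3DensityOn f a b) {x : ℝ} (hx : x ∈ Ioo a b) : 0 < f x := by
  rw [← hf.support_eq] at hx
  exact lt_of_le_of_ne (hf.nonneg x) (Ne.symm hx)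

lemma eq_zero (hf : IsC3DensityOn f a b) {x : ℝ} (hx : x ∉ Ioo a b) : f x = 0 := by
  rw [← hf.support_eq] at hx
  exact Function.notMem_support.1 hx

lemma measurable (hf : IsC3DensityOn f a b) : Measurable f := by
  classical
  have h := hf.contDiffOn.continuousOn.measurable_piecewise
    (continuousOn_const (c := (0 : ℝ)) (s := (Ioo a b)ᶜ)) measurableSet_Ioo
  convert h using 1
  ext x
  by_cases hx : x ∈ Ioo a b
  · simp only [piecewise_eq_of_mem _ _ _ hx]
  · simp only [piecewise_eq_of_notMem _ _ _ hx, hf.eq_zero hx]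

lemma edgeProfile_left (hf : IsC3DensityOn f a b) {κ A : ℝ}
    (h : EndpointBehavior (fun x => f (a + x)) κ A) :
    EdgeProfile (fun x => f (a + x)) κ A (b - a) where
  measurable := hf.measurable.comp (by fun_prop)
  nonneg _ := hf.nonneg _
  zero u hu := hf.eq_zero fun h => by linarith [h.1]
  pos u hu := hf.pos ⟨by linarith [hu.1], by linarith [hu.2]⟩
  contDiffOn := hf.contDiffOn.comp (by fun_prop)
    fun u hu => ⟨by linarith [hu.1], by linarith [hu.2]⟩
  behavior := h

lemma edgeProfile_right (hf : IsC3DensityOn f a b) {κ A : ℝ}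
    (h : EndpointBehavior (fun x => f (b - x)) κ A) :
    EdgeProfile (fun x => f (b - x)) κ A (b - a) where
  measurable := hf.measurable.comp (by fun_prop)
  nonneg _ := hf.nonneg _
  zero u hu := hf.eq_zero fun h => by linarith [h.2]
  pos u hu := hf.pos ⟨by linarith [hu.2], by linarith [hu.1]⟩
  contDiffOn := hf.contDiffOn.comp (by fun_prop)
    fun u hu => ⟨by linarith [hu.2], by linarith [hu.1]⟩
  behavior := h

/-- The gap lives on `[a, b + ε]`, whose midpoint is the cut. On the right half `u = b + ε - y`
turns `f (y - ε)` into the unshifted profile and `f y` into the shifted one, so the weight becomes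
`1 - s`. -/
lemma integral_gap_eq (hf : IsC3DensityOn f a b) {ε s : ℝ} (hε : 0 < ε) (hs : s ∈ Ioo (0 : ℝ) 1)
    (hi : Integrable fun y => amgmGap s (f y) (f (y - ε))) :
    ∫ y, amgmGap s (f y) (f (y - ε)) =
      edgeInt (fun x => f (a + x)) (b - a) ε s + edgeInt (fun x => f (b - x)) (b - a) ε (1 - s) := by
  have hab := hf.lt
  have hsupp : Function.support (fun y => amgmGap s (f y) (f (y - ε))) ⊆ Ioc a (b + ε) := by
    intro y hy
    by_contra hn
    refine hy ?_
    have h1 : f y = 0 := hf.eq_zero fun h => hn ⟨h.1, by linarith [h.2]⟩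
    have h2 : f (y - ε) = 0 := hf.eq_zero fun h => hn ⟨by linarith [h.1], by linarith [h.2]⟩
    simp only [h1, h2]
    rw [amgmGap_zero_right hs.2.ne, mul_zero]
  rw [← intervalIntegral.integral_eq_integral_of_support_subset hsupp,
    ← intervalIntegral.integral_add_adjacent_intervals (b := (a + b + ε) / 2)
      hi.intervalIntegrable hi.intervalIntegrable]
  unfold edgeInt
  rw [← intervalIntegral.integral_of_le (by linarith), ← intervalIntegral.integral_of_le (by linarith)]
  congr 1
  · have := intervalIntegral.integral_comp_add_left (a := 0) (b := (b - a + ε) / 2)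
      (fun y => amgmGap s (f y) (f (y - ε))) a
    rw [add_zero, show a + (b - a + ε) / 2 = (a + b + ε) / 2 by ring] at this
    rw [← this]
    simp only [add_sub_assoc]
  · have := intervalIntegral.integral_comp_sub_left (a := 0) (b := (b - a + ε) / 2)
      (fun y => amgmGap s (f y) (f (y - ε))) (b + ε)
    rw [sub_zero, show b + ε - (b - a + ε) / 2 = (a + b + ε) / 2 by ring] at this
    rw [← this]
    congr 1 with u
    beta_reduce
    rw [amgmGap_symm, show b - (u - ε) = b + ε - u by ring, show b + ε - u - ε = b - u by ring]

lemma relRenyi_eq (hf : IsC3DensityOn f a b) {ε s : ℝ} (θ : ℝ) (hε : 0 < ε)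
    (hs : s ∈ Ioo (0 : ℝ) 1) :
    relRenyi s (locShift f θ) (locShift f (θ + ε)) =
      -Real.log (1 - (edgeInt (fun x => f (a + x)) (b - a) ε s +
        edgeInt (fun x => f (b - x)) (b - a) ε (1 - s))) := by
  have hs' := Ioo_subset_Icc_self hs
  have i1 : Integrable f := hf.integrable
  have i2 : Integrable fun y => f (y - ε) := i1.comp_sub_right ε
  have hi : Integrable fun y => amgmGap s (f y) (f (y - ε)) := by
    refine Integrable.mono' (i1.add i2) (measurable_amgmGap hf.measurable
      (hf.measurable.comp (by fun_prop))).aestronglyMeasurable (Eventually.of_forall fun y => ?_)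
    rw [Real.norm_of_nonneg (amgmGap_nonneg hs' (hf.nonneg _) (hf.nonneg _))]
    exact amgmGap_le_add hs' (hf.nonneg _) (hf.nonneg _)
  unfold relRenyi locShift
  rw [← hf.integral_gap_eq hε hs hi]
  congr 2
  have e1 : ∫ x, f (x - θ) ^ s * f (x - (θ + ε)) ^ (1 - s) =
      ∫ y, f y ^ s * f (y - ε) ^ (1 - s) := by
    rw [← integral_sub_right_eq_self (fun y => f y ^ s * f (y - ε) ^ (1 - s)) θ]
    simp only [sub_sub]
  have e2 : ∀ y, f y ^ s * f (y - ε) ^ (1 - s) =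
      s * f y + (1 - s) * f (y - ε) - amgmGap s (f y) (f (y - ε)) := fun y => by
    unfold amgmGap; ring
  have i3 : Integrable fun y => s * f y + (1 - s) * f (y - ε) :=
    (i1.const_mul s).add (i2.const_mul (1 - s))
  rw [e1]
  simp only [e2]
  rw [integral_sub i3 hi,
    integral_add (i1.const_mul s) (i2.const_mul (1 - s)), integral_const_mul, integral_const_mul,
    integral_sub_right_eq_self f ε, hf.integral_eq_one]
  ring

/-- Asking for the limits at every real `s₀` costs nothing beyond `[0, 1]`, since there the filter
within `(0, 1)` is trivial. -/
lemma tendstoUniformlyOn_relRenyi (hf : IsC3DensityOn f a b) (θ : ℝ) {w c₁ c₂ G : ℝ → ℝ}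
    (hw : Tendsto w (𝓝[>] 0) (𝓝 0)) (hw0 : ∀ᶠ ε in 𝓝[>] 0, w ε ≠ 0)
    (h₁ : ∀ s₀, Tendsto (fun z : ℝ × ℝ => edgeInt (fun x => f (a + x)) (b - a) z.1 z.2 / w z.1)
      (𝓝[>] 0 ×ˢ 𝓝[Ioo 0 1] s₀) (𝓝 (c₁ s₀)))
    (h₂ : ∀ s₀, Tendsto (fun z : ℝ × ℝ => edgeInt (fun x => f (b - x)) (b - a) z.1 z.2 / w z.1)
      (𝓝[>] 0 ×ˢ 𝓝[Ioo 0 1] s₀) (𝓝 (c₂ s₀)))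
    (hG : ∀ s ∈ Ioo (0 : ℝ) 1, c₁ s + c₂ (1 - s) = G s) :
    TendstoUniformlyOn (fun ε s => relRenyi s (locShift f θ) (locShift f (θ + ε)) / w ε) G
      (𝓝[>] 0) (Ioo 0 1) := by
  refine tendstoUniformlyOn_of_tendsto_prod (c := fun s => c₁ s + c₂ (1 - s)) (fun s₀ _ => ?_) hG
  have hrefl : Tendsto (fun z : ℝ × ℝ => (z.1, 1 - z.2)) (𝓝[>] 0 ×ˢ 𝓝[Ioo 0 1] s₀)
      (𝓝[>] 0 ×ˢ 𝓝[Ioo 0 1] (1 - s₀)) := by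
    refine tendsto_fst.prodMk (tendsto_nhdsWithin_iff.2 ⟨tendsto_snd_nhds.const_sub 1, ?_⟩)
    filter_upwards [eventually_snd_mem] with z hz
    exact ⟨by linarith [hz.2], by linarith [hz.1]⟩
  have hsum := (h₁ s₀).add ((h₂ (1 - s₀)).comp hrefl)
  simp only [Function.comp_apply, ← add_div] at hsum
  refine (tendsto_neg_log_one_sub_div (hw.comp tendsto_fst) (tendsto_fst.eventually hw0)
    hsum).congr' ?_
  filter_upwards [eventually_fst_pos, eventually_snd_mem] with z hz hs
  rw [hf.relRenyi_eq θ hz hs]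
  rfl

lemma integral_fisher_eq (hf : IsC3DensityOn f a b)
    (h₁ : IntegrableOn (fun u => (f (a + u))⁻¹ * deriv (fun x => f (a + x)) u ^ 2)
      (Ioo 0 ((b - a) / 2)))
    (h₂ : IntegrableOn (fun u => (f (b - u))⁻¹ * deriv (fun x => f (b - x)) u ^ 2)
      (Ioo 0 ((b - a) / 2))) :
    IntegrableOn (fun x => (f x)⁻¹ * deriv f x ^ 2) (Ioo a b) ∧
    fisherIntegral f a b =
      (∫ u in Ioo 0 ((b - a) / 2), (f (a + u))⁻¹ * deriv (fun x => f (a + x)) u ^ 2) +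
      ∫ u in Ioo 0 ((b - a) / 2), (f (b - u))⁻¹ * deriv (fun x => f (b - x)) u ^ 2 := by
  have hab := hf.lt
  have h0 : 0 ≤ (b - a) / 2 := by linarith
  set φ : ℝ → ℝ := fun x => (f x)⁻¹ * deriv f x ^ 2 with hφ
  have e1 : (fun u => (f (a + u))⁻¹ * deriv (fun x => f (a + x)) u ^ 2) = fun u => φ (a + u) := by
    ext u; simp only [hφ]; rw [deriv_comp_const_add]
  have e2 : (fun u => (f (b - u))⁻¹ * deriv (fun x => f (b - x)) u ^ 2) = fun u => φ (b - u) := by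
    ext u; simp only [hφ]; rw [deriv_comp_const_sub, neg_sq]
  rw [e1] at h₁ ⊢
  rw [e2] at h₂ ⊢
  rw [← intervalIntegrable_iff_integrableOn_Ioo_of_le h0] at h₁ h₂
  have j1 := h₁.comp_sub_right a
  have j2 := (h₂.comp_sub_left b).symm
  simp only [add_sub_cancel, sub_sub_cancel, zero_add, sub_zero] at j1 j2
  rw [show (b - a) / 2 + a = (a + b) / 2 by ring] at j1
  rw [show b - (b - a) / 2 = (a + b) / 2 by ring] at j2
  refine ⟨(intervalIntegrable_iff_integrableOn_Ioo_of_le hab.le).1 (j1.trans j2), ?_⟩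
  unfold fisherIntegral
  rw [← integral_Ioc_eq_integral_Ioo, ← integral_Ioc_eq_integral_Ioo,
    ← integral_Ioc_eq_integral_Ioo, ← intervalIntegral.integral_of_le hab.le,
    ← intervalIntegral.integral_of_le h0, ← intervalIntegral.integral_of_le h0,
    intervalIntegral.integral_comp_add_left φ a, intervalIntegral.integral_comp_sub_left φ b,
    ← intervalIntegral.integral_add_adjacent_intervals j1 j2]
  congr 2 <;> ring

end IsC3DensityOn

/-! ### Assembling the cases -/

lemma tendsto_sq_mul_log : Tendsto (fun ε : ℝ => -ε ^ 2 * Real.log ε) (𝓝[>] 0) (𝓝 0) := by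
  have := (tendsto_log_mul_rpow_nhdsGT_zero (r := 2) two_pos).neg
  rw [neg_zero] at this
  refine this.congr fun ε => ?_
  rw [Real.rpow_two]; ring

lemma tendsto_rpow_nhdsGT {κ : ℝ} (h0 : 0 < κ) :
    Tendsto (fun ε : ℝ => ε ^ κ) (𝓝[>] 0) (𝓝 0) := by
  have := (Real.continuousAt_rpow_const 0 κ (Or.inr h0.le)).tendsto
  rw [Real.zero_rpow h0.ne'] at this
  exact this.mono_left nhdsWithin_le_nhds

namespace EdgeProfile

variable {h : ℝ → ℝ} {κ κ' A L : ℝ}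

lemma tendsto_edgeInt_lt_two (hp : EdgeProfile h κ A L) (hL : 0 < L) (h2 : κ < 2) (s₀ : ℝ) :
    Tendsto (fun z : ℝ × ℝ => edgeInt h L z.1 z.2 / z.1 ^ κ)
      (𝓝[>] 0 ×ˢ 𝓝[Ioo 0 1] s₀) (𝓝 (A * edgeConst κ s₀)) :=
  -- Any `R` strictly between `L / 2` and `L` works: it covers the half interval with room for `ε`
  -- and avoids the far endpoint.
  tendsto_edgeInt_of_lt_two hp.behavior.pos h2 hL (R := 3 * L / 4) (by linarith)
    (hp.edgeBound (by linarith) (by linarith)) (hp.coeff_pos hL).le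
    (tendsto_div_rpow_of_isEquivalent hp.behavior.equiv_zero)

lemma tendsto_edgeInt_lt_two_of_lt (hp : EdgeProfile h κ' A L) (hL : 0 < L) (h0 : 0 < κ)
    (h2 : κ < 2) (hκ : κ < κ') (s₀ : ℝ) :
    Tendsto (fun z : ℝ × ℝ => edgeInt h L z.1 z.2 / z.1 ^ κ)
      (𝓝[>] 0 ×ˢ 𝓝[Ioo 0 1] s₀) (𝓝 (0 * edgeConst κ s₀)) :=
  tendsto_edgeInt_of_lt_two h0 h2 hL (R := 3 * L / 4) (by linarith)
    ((hp.edgeBound (by linarith) (by linarith)).mono hκ.le (by linarith)) le_rfl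
    (tendsto_div_rpow_of_lt hκ (tendsto_div_rpow_of_isEquivalent hp.behavior.equiv_zero))

lemma tendsto_edgeInt_two_lt (hp : EdgeProfile h κ A L) (hL : 0 < L) (h2 : 2 < κ) :
    IntegrableOn (fun u => (h u)⁻¹ * deriv h u ^ 2) (Ioo 0 (L / 2)) ∧
    ∀ s₀, Tendsto (fun z : ℝ × ℝ => edgeInt h L z.1 z.2 / z.1 ^ 2) (𝓝[>] 0 ×ˢ 𝓝[Ioo 0 1] s₀)
      (𝓝 (s₀ * (1 - s₀) / 2 * ∫ u in Ioo 0 (L / 2), (h u)⁻¹ * deriv h u ^ 2)) :=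
  tendsto_edgeInt_of_two_lt h2 hL (R := 3 * L / 4) (by linarith)
    (hp.edgeBound (by linarith) (by linarith))
    (fun _ hu => hp.differentiableAt ⟨hu.1, by linarith [hu.2]⟩)
    (fun _ hu => hp.pos _ ⟨hu.1, by linarith [hu.2]⟩)

lemma tendsto_edgeInt_two (hp : EdgeProfile h 2 A L) (hL : 0 < L) (s₀ : ℝ) :
    Tendsto (fun z : ℝ × ℝ => edgeInt h L z.1 z.2 / (-z.1 ^ 2 * Real.log z.1))
      (𝓝[>] 0 ×ˢ 𝓝[Ioo 0 1] s₀) (𝓝 (A * (s₀ * (1 - s₀) / 2))) := by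
  have h1 := tendsto_div_rpow_of_isEquivalent hp.behavior.equiv_zero
  have h2 := tendsto_div_rpow_of_isEquivalent (hp.behavior.equiv_one (by norm_num))
  norm_num at h1 h2
  exact tendsto_edgeInt_of_eq_two hL (R := 3 * L / 4) (by linarith)
    (hp.edgeBound (by linarith) (by linarith)) (hp.coeff_pos hL)
    (fun _ hu => hp.differentiableAt ⟨hu.1, by linarith [hu.2]⟩)
    (fun _ hu => hp.pos _ ⟨hu.1, by linarith [hu.2]⟩) h1 h2

/-- This contribution converges already after division by `ε^2`, so the additional `log ε` sends it
to zero. -/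
lemma tendsto_edgeInt_two_of_lt (hp : EdgeProfile h κ A L) (hL : 0 < L) (hκ : 2 < κ) (s₀ : ℝ) :
    Tendsto (fun z : ℝ × ℝ => edgeInt h L z.1 z.2 / (-z.1 ^ 2 * Real.log z.1))
      (𝓝[>] 0 ×ˢ 𝓝[Ioo 0 1] s₀) (𝓝 (0 * (s₀ * (1 - s₀) / 2))) := by
  have hlog := (Real.tendsto_log_nhdsGT_zero.comp
    (tendsto_fst (f := 𝓝[>] (0 : ℝ)) (g := 𝓝[Ioo 0 1] s₀))).inv_tendsto_atBot
  have := (((hp.tendsto_edgeInt_two_lt hL hκ).2 s₀).mul hlog).neg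
  rw [mul_zero, neg_zero] at this
  rw [zero_mul]
  refine this.congr fun z => ?_
  simp only [Pi.inv_apply, Function.comp_apply]
  rw [neg_mul, div_neg, div_mul_eq_div_div, div_eq_mul_inv (_ / _) (Real.log z.1)]

end EdgeProfile

/-- The limits follow from the leading order contributions of the two endpoints. -/
lemma renyiLimits_of_edges {f : ℝ → ℝ} {a b κ κ₂ A₁ A₂ A : ℝ} (θ : ℝ) (hf : IsC3DensityOn f a b)
    (h₁ : EndpointBehavior (fun x => f (a + x)) κ A₁)
    (h₂ : EndpointBehavior (fun x => f (b - x)) κ₂ A₂) (hκ : κ ≤ κ₂)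
    (hlt : κ < 2 → ∀ s₀, Tendsto
      (fun z : ℝ × ℝ => edgeInt (fun x => f (b - x)) (b - a) z.1 z.2 / z.1 ^ κ)
      (𝓝[>] 0 ×ˢ 𝓝[Ioo 0 1] s₀) (𝓝 (A * edgeConst κ s₀)))
    (heq : κ = 2 → ∀ s₀, Tendsto (fun z : ℝ × ℝ =>
      edgeInt (fun x => f (b - x)) (b - a) z.1 z.2 / (-z.1 ^ 2 * Real.log z.1))
      (𝓝[>] 0 ×ˢ 𝓝[Ioo 0 1] s₀) (𝓝 (A * (s₀ * (1 - s₀) / 2)))) :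
    RenyiLimits f a b κ A₁ A θ := by
  have hL : 0 < b - a := sub_pos.2 hf.lt
  have hp₁ := hf.edgeProfile_left h₁
  have hp₂ := hf.edgeProfile_right h₂
  have hpow0 : ∀ p : ℝ, ∀ᶠ ε : ℝ in 𝓝[>] 0, ε ^ p ≠ 0 := fun p => by
    filter_upwards [self_mem_nhdsWithin] with ε hε using (Real.rpow_pos_of_pos hε p).ne'
  have hbelow : κ < 2 → ∀ G : ℝ → ℝ,
      (∀ s ∈ Ioo (0 : ℝ) 1, A₁ * edgeConst κ s + A * edgeConst κ (1 - s) = G s) →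
      TendstoUniformlyOn (fun ε s => relRenyi s (locShift f θ) (locShift f (θ + ε)) / ε ^ κ) G
        (𝓝[>] 0) (Ioo 0 1) := fun h2 G hG =>
    hf.tendstoUniformlyOn_relRenyi θ (tendsto_rpow_nhdsGT h₁.pos) (hpow0 κ)
      (hp₁.tendsto_edgeInt_lt_two hL h2) (hlt h2) hG
  have hrefl : ∀ s ∈ Ioo (0 : ℝ) 1, 1 - s ∈ Ioo (0 : ℝ) 1 := fun s hs =>
    ⟨by linarith [hs.2], by linarith [hs.1]⟩
  refine ⟨fun h0 h1 => ?_, fun h1 => ?_, fun h1 h2 => ?_, fun h2 => ?_, fun h2 => ?_⟩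
  · refine hbelow (by linarith) _ fun s hs => ?_
    rw [edgeConst_eq_of_lt_one h0 h1 hs, edgeConst_eq_of_lt_one h0 h1 (hrefl s hs), sub_sub_cancel]
    ring
  · refine hbelow (by linarith) _ fun s hs => ?_
    rw [h1, edgeConst_one hs, edgeConst_one (hrefl s hs)]
  · refine hbelow h2 _ fun s hs => ?_
    rw [edgeConst_eq h₁.pos h2 hs, edgeConst_eq h₁.pos h2 (hrefl s hs), sub_sub_cancel]
    ring
  · subst h2
    refine hf.tendstoUniformlyOn_relRenyi θ tendsto_sq_mul_log ?_ (hp₁.tendsto_edgeInt_two hL)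
      (heq rfl) fun s _ => by ring
    filter_upwards [Ioo_mem_nhdsGT one_pos] with ε hε
    exact mul_ne_zero (neg_ne_zero.2 (pow_ne_zero 2 hε.1.ne')) (Real.log_neg hε.1 hε.2).ne
  -- Both exponents exceed `2` here, so each endpoint supplies its half of the Fisher integral and
  -- `A` plays no role.
  · obtain ⟨i₁, t₁⟩ := hp₁.tendsto_edgeInt_two_lt hL h2
    obtain ⟨i₂, t₂⟩ := hp₂.tendsto_edgeInt_two_lt hL (h2.trans_le hκ)
    obtain ⟨hi, hJ⟩ := hf.integral_fisher_eq i₁ i₂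
    refine ⟨hi, hf.tendstoUniformlyOn_relRenyi θ ?_ ?_ t₁ t₂ fun s _ => ?_⟩
    · simpa using tendsto_rpow_nhdsGT (κ := 2) two_pos
    · simpa using hpow0 2
    · rw [hJ]; ring

theorem theorem1 (f : ℝ → ℝ) (a b κ₁ κ₂ A₁ A₂ θ : ℝ)
    (hf : IsC3DensityOn f a b)
    (h₁ : EndpointBehavior (fun x => f (a + x)) κ₁ A₁)
    (h₂ : EndpointBehavior (fun x => f (b - x)) κ₂ A₂) :
    (κ₁ = κ₂ → RenyiLimits f a b κ₁ A₁ A₂ θ) ∧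
    (κ₁ < κ₂ → RenyiLimits f a b κ₁ A₁ 0 θ) := by
  have hL : 0 < b - a := sub_pos.2 hf.lt
  have hp₂ := hf.edgeProfile_right h₂
  constructor
  · rintro rfl
    refine renyiLimits_of_edges θ hf h₁ h₂ le_rfl (fun h => hp₂.tendsto_edgeInt_lt_two hL h) ?_
    rintro rfl
    exact hp₂.tendsto_edgeInt_two hL
  · intro hκ
    refine renyiLimits_of_edges θ hf h₁ h₂ hκ.le
      (fun h => hp₂.tendsto_edgeInt_lt_two_of_lt hL h₁.pos h hκ) ?_
    rintro rfl
    exact hp₂.tendsto_edgeInt_two_of_lt hL hκ
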